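/- A \emph{triangulated planar graph} is a finite simple graph that can be drawn in the plane without crossings (vertices as distinct points, edges as simple arcs) such that every face, including the outer face, is bounded by a cycle of length $3$. The $W\times H$-grid has vertex set $\{1,\dots,W\}\times\{1,\dots,H\}$ and an edge between any two grid-points at distance one; $H$ is its height. A \emph{grid-representation} of a graph $G$ labels each grid-point of some $W\times H$-grid with a vertex of $G$ such that (1) every vertex of $G$ appears as a label, (2) for every vertex $v$ the grid-points labelled $v$ induce a connected subgraph of the grid, and (3) for every edge $vw$ of $G$ some grid-edge has its ends labelled $v$ and $w$. It is \emph{simple} if, in addition, in every column and for every vertex $v$ the grid-points of that column labelled $v$ induce a connected (possibly empty) subgraph. The \emph{grid-major height} $\mathrm{GMh}(G)$ (respectively the \emph{simple grid-major height} $\mathrm{sGMh}(G)$) is the smallest height of a grid for which $G$ has a grid-representation (respectively a simple grid-representation). There are triangulated planar graphs whose grid-major height is at most $4$ but whose simple grid-major height is $\Omega(n)$, where $n$ is the number of vertices. Precisely: there is a constant $c>0$ such that for every $n\ge 3$ there exists a triangulated planar graph $G$ with $n$ vertices such that $\mathrm{GMh}(G)\le 4$, and $\mathrm{sGMh}(G)$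 is finite with $\mathrm{sGMh}(G)\ge c\,n$. -/

import Mathlib

/-- A drawing without crossings of the graph `G` in the plane `ℝ × ℝ`: vertices are distinct points,
every edge `s(u, v)` is a simple arc joining the points of `u` and `v`, an edge contains no point of
a non-incident vertex, and two different edges meet only in points of common end vertices.
(The value of `arc` on pairs that are not edges is irrelevant.) -/
structure PlaneDrawing {V : Type*} (G : SimpleGraph V) where
  pos : V → ℝ × ℝ
  arc : Sym2 V → Set (ℝ × ℝ)
  pos_injective : Function.Injective pos
  arc_simple : ∀ u v : V, G.Adj u v →
    ∃ γ : Path (pos u) (pos v), Function.Injective γ ∧ Set.range γ = arc s(u, v)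
  arc_vertex : ∀ e ∈ G.edgeSet, ∀ w : V, pos w ∈ arc e → w ∈ e
  arc_inter : ∀ e ∈ G.edgeSet, ∀ e' ∈ G.edgeSet, e ≠ e' →
    ∀ p ∈ arc e ∩ arc e', ∃ w : V, w ∈ e ∧ w ∈ e' ∧ p = pos w

namespace PlaneDrawing

variable {V : Type*} {G : SimpleGraph V}

/-- The point set covered by the drawing. -/
def support (D : PlaneDrawing G) : Set (ℝ × ℝ) :=
  Set.range D.pos ∪ ⋃ e ∈ G.edgeSet, D.arc e

/-- The faces (the outer-face included): the maximal connected regions that remain when the drawing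
is removed from the plane. -/
def IsFace (D : PlaneDrawing G) (F : Set (ℝ × ℝ)) : Prop :=
  ∃ p ∈ D.supportᶜ, F = connectedComponentIn D.supportᶜ p

/-- The region `F` is bounded by a cycle of length 3 of `G`. -/
def IsBoundedByTriangle (D : PlaneDrawing G) (F : Set (ℝ × ℝ)) : Prop :=
  ∃ u v w : V, G.Adj u v ∧ G.Adj v w ∧ G.Adj w u ∧
    frontier F = D.arc s(u, v) ∪ D.arc s(v, w) ∪ D.arc s(w, u)

end PlaneDrawing

/-- Triangulated planar graphs: simple graphs with a plane drawing all of whose faces, including the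
outer-face, are bounded by a 3-cycle. -/
def IsTriangulatedPlanar {V : Type*} (G : SimpleGraph V) : Prop :=
  ∃ D : PlaneDrawing G, ∀ F : Set (ℝ × ℝ), D.IsFace F → D.IsBoundedByTriangle F

/-- The `W × H`-grid: `W` columns (first coordinate) and `H` rows (second coordinate), with an edge
between any two grid-points of distance one. -/
def gridGraph (W H : ℕ) : SimpleGraph (Fin W × Fin H) :=
  (SimpleGraph.pathGraph W).boxProd (SimpleGraph.pathGraph H)

/-- The labelling `label` of the `W × H`-grid is a grid-representation of `G`. -/
structure IsGridRepresentation {V : Type*} (G : SimpleGraph V) {W H : ℕ}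
    (label : Fin W × Fin H → V) : Prop where
  surjective : Function.Surjective label
  connected : ∀ v : V, ((gridGraph W H).induce {p | label p = v}).Connected
  edge : ∀ v w : V, G.Adj v w →
    ∃ p q : Fin W × Fin H, (gridGraph W H).Adj p q ∧ label p = v ∧ label q = w

/-- The labelling `label` is a simple grid-representation of `G`: moreover, in every column `c` the
grid-points with the same label induce a connected (possibly empty) subgraph. -/
structure IsSimpleGridRepresentation {V : Type*} (G : SimpleGraph V) {W H : ℕ}
    (label : Fin W × Fin H → V) : Prop extends IsGridRepresentation G label where
  column_connected : ∀ (c : Fin W) (v : V),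
    ((gridGraph W H).induce {p | p.1 = c ∧ label p = v}).Preconnected

/-- The grid-major height of `G`: the smallest `h` such that `G` has a grid-representation in a grid
of height `h` (`⊤` if there is none). -/
noncomputable def gridMajorHeight {V : Type*} (G : SimpleGraph V) : ℕ∞ :=
  ⨅ (h : ℕ) (_ : ∃ (W : ℕ) (label : Fin W × Fin h → V), IsGridRepresentation G label), (h : ℕ∞)

/-- The simple grid-major height of `G`: the smallest `h` such that `G` has a simple
grid-representation in a grid of height `h` (`⊤` if there is none). -/
noncomputable def simpleGridMajorHeight {V : Type*} (G : SimpleGraph V) : ℕ∞ :=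
  ⨅ (h : ℕ) (_ : ∃ (W : ℕ) (label : Fin W × Fin h → V), IsSimpleGridRepresentation G label), (h : ℕ∞)

/-! The witness is the cone with apex `0` over the squared path `1, …, n - 1`.

It is a stacked triangulation: every vertex `k ≥ 3` is put inside the triangle on `0`, `k - 2`, `k -
1` and joined to its corners. The next vertex goes into the part with corners `0`, `k - 1`, `k`, so
the drawing is a nested sequence of triangles, analysed in linear coordinates that turn each one
into the same model triangle (`squaredPathCone_isTriangulatedPlanar`).

Height `4` suffices without simplicity because the apex may surround the path: odd and even path
vertices take the two middle rows, and the apex takes both outer rows, linked by the first column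
(`isGridRepresentation_lowConeLabel`). That the simple height is finite is shown by an explicit
labelling (`isSimpleGridRepresentation_nestedConeLabel`).

For the lower bound, fix a point `p` labelled `1` and a point `q` labelled `n - 1`. The triangle
`0`, `i`, `i + 1` separates the vertices below `i` from those above `i + 1`, and
`planeGrid_separates` transfers this to the grid. In a simple representation the apex lies on at
most one side of `p` in its column, so a vertical ray from `p` leaves the grid without meeting the
apex; likewise for `q`. If neither column contained `i` or `i + 1`, the two rays would join outside
the grid and avoid the separating triangle. So linearly many disjoint pairs `i`, `i + 1` all need
points in two columns, which have `2H` points (`IsSimpleGridRepresentation.le_height`).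

The separation is the nonplanarity of `K₅` in disguise: five connected sets, adjacent except for one
pair, plus a walk joining that pair. It is proved by counting crossings mod 2 after shifting one of
each two walks by `(1/2, 1/2)`, which avoids any use of the Jordan curve theorem. -/

/-- The square of a path on the vertices `1, …, n - 1` together with a vertex `0` adjacent to all
of them. -/
def squaredPathCone (n : ℕ) : SimpleGraph (Fin n) where
  Adj u v := u ≠ v ∧ (u.val = 0 ∨ v.val = 0 ∨ (u.val ≤ v.val + 2 ∧ v.val ≤ u.val + 2))
  symm := ⟨fun u v h => ⟨h.1.symm, by omega⟩⟩
  loopless := ⟨fun u h => h.1 rfl⟩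

theorem squaredPathCone_adj {n : ℕ} {u v : Fin n} : (squaredPathCone n).Adj u v ↔
    u ≠ v ∧ (u.val = 0 ∨ v.val = 0 ∨ (u.val ≤ v.val + 2 ∧ v.val ≤ u.val + 2)) := Iff.rfl

/-! ### The model triangle: closure, frontier and complement -/

section Triangle

/-- The open triangle with corners `(0, 0)`, `(1, 0)` and `(0, 1)`. -/
def openTriangle : Set (ℝ × ℝ) := {p | 0 < p.1 ∧ 0 < p.2 ∧ p.1 + p.2 < 1}

/-- The closed triangle with corners `(0, 0)`, `(1, 0)` and `(0, 1)`. -/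
def closedTriangle : Set (ℝ × ℝ) := {p | 0 ≤ p.1 ∧ 0 ≤ p.2 ∧ p.1 + p.2 ≤ 1}

/-- The boundary of the triangle with corners `a`, `b` and `c`. -/
def triangleBoundary (a b c : ℝ × ℝ) : Set (ℝ × ℝ) :=
  segment ℝ a b ∪ segment ℝ b c ∪ segment ℝ c a

theorem isOpen_openTriangle : IsOpen openTriangle := by
  have h₁ : IsOpen {p : ℝ × ℝ | 0 < p.1} := isOpen_lt (by fun_prop) (by fun_prop)
  have h₂ : IsOpen {p : ℝ × ℝ | 0 < p.2} := isOpen_lt (by fun_prop) (by fun_prop)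
  have h₃ : IsOpen {p : ℝ × ℝ | p.1 + p.2 < 1} := isOpen_lt (by fun_prop) (by fun_prop)
  exact h₁.inter (h₂.inter h₃)

theorem isClosed_closedTriangle : IsClosed closedTriangle := by
  have h₁ : IsClosed {p : ℝ × ℝ | 0 ≤ p.1} := isClosed_le (by fun_prop) (by fun_prop)
  have h₂ : IsClosed {p : ℝ × ℝ | 0 ≤ p.2} := isClosed_le (by fun_prop) (by fun_prop)
  have h₃ : IsClosed {p : ℝ × ℝ | p.1 + p.2 ≤ 1} := isClosed_le (by fun_prop) (by fun_prop)
  exact h₁.inter (h₂.inter h₃)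

theorem convex_openTriangle : Convex ℝ openTriangle := by
  rintro ⟨x, y⟩ ⟨hx, hy, hxy⟩ ⟨x', y'⟩ ⟨hx', hy', hxy'⟩ s t hs ht hst
  simp only at hx hy hxy hx' hy' hxy'
  obtain rfl : t = 1 - s := by linarith
  simp only [openTriangle, Set.mem_ofPred_eq, Prod.fst_add, Prod.snd_add, Prod.smul_fst,
    Prod.smul_snd, smul_eq_mul]
  rcases hs.eq_or_lt with rfl | hs
  · simp_all
  · refine ⟨?_, ?_, ?_⟩ <;> nlinarith [mul_pos hs hx, mul_pos hs hy]

theorem closure_openTriangle : closure openTriangle = closedTriangle := by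
  refine subset_antisymm (closure_minimal ?_ isClosed_closedTriangle) ?_
  · rintro p ⟨h₁, h₂, h₃⟩
    exact ⟨h₁.le, h₂.le, h₃.le⟩
  · rintro ⟨x, y⟩ ⟨h₁, h₂, h₃⟩
    simp only at h₁ h₂ h₃
    -- Moving a boundary point towards the centroid `(1/3, 1/3)` enters the open triangle at once.
    have hlim : Filter.Tendsto (fun t : ℝ => (x + t * (1 / 3 - x), y + t * (1 / 3 - y)))
        (nhdsWithin 0 (Set.Ioi 0)) (nhds (x, y)) := by
      have : Continuous fun t : ℝ => (x + t * (1 / 3 - x), y + t * (1 / 3 - y)) := by fun_prop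
      simpa using (this.tendsto 0).mono_left nhdsWithin_le_nhds
    refine mem_closure_of_tendsto hlim ?_
    filter_upwards [Ioo_mem_nhdsGT (zero_lt_one' ℝ)] with t ht
    refine ⟨?_, ?_, ?_⟩ <;> simp only <;> nlinarith [ht.1, ht.2]

theorem frontier_openTriangle : frontier openTriangle = triangleBoundary (0, 0) (1, 0) (0, 1) := by
  rw [frontier, closure_openTriangle, isOpen_openTriangle.interior_eq]
  ext ⟨x, y⟩
  simp only [closedTriangle, openTriangle, triangleBoundary, Set.mem_sdiff, Set.mem_ofPred_eq,
    Set.mem_union, segment, Prod.mk.injEq, Prod.smul_mk, Prod.mk_add_mk, smul_eq_mul]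
  constructor
  · rintro ⟨⟨h₁, h₂, h₃⟩, h⟩
    rcases h₁.eq_or_lt with h₁' | h₁'
    · exact Or.inr ⟨y, 1 - y, h₂, by linarith, by ring, by linarith, by ring⟩
    rcases h₂.eq_or_lt with h₂' | h₂'
    · exact Or.inl (Or.inl ⟨1 - x, x, by linarith, h₁, by ring, by ring, by linarith⟩)
    · have : x + y = 1 := le_antisymm h₃ (not_lt.1 fun h₃' => h ⟨h₁', h₂', h₃'⟩)
      exact Or.inl (Or.inr ⟨x, y, h₁, h₂, this, by ring, by ring⟩)
  · rintro ((⟨s, t, hs, ht, hst, hx, hy⟩ | ⟨s, t, hs, ht, hst, hx, hy⟩) |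
      ⟨s, t, hs, ht, hst, hx, hy⟩) <;>
    refine ⟨⟨by linarith, by linarith, by linarith⟩, fun h => ?_⟩ <;>
    linarith [h.1, h.2.1, h.2.2]

theorem frontier_compl_closedTriangle :
    frontier closedTriangleᶜ = triangleBoundary (0, 0) (1, 0) (0, 1) := by
  have hne : (interior openTriangle).Nonempty := by
    rw [isOpen_openTriangle.interior_eq]
    exact ⟨(1 / 3, 1 / 3), by norm_num [openTriangle]⟩
  rw [frontier_compl, ← frontier_openTriangle, frontier, frontier, ← closure_openTriangle,
    closure_closure, convex_openTriangle.interior_closure_eq_interior_of_nonempty_interior hne]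

/-- The complement is a union of three half-planes that overlap pairwise; `(-1, -1)` and `(-1, 3)`
are the common points used to glue them. -/
theorem isPreconnected_compl_closedTriangle : IsPreconnected closedTriangleᶜ := by
  have h₁ : Convex ℝ {p : ℝ × ℝ | p.1 < 0} :=
    convex_halfSpace_lt (IsLinearMap.mk (by simp) (by simp)) 0
  have h₂ : Convex ℝ {p : ℝ × ℝ | p.2 < 0} :=
    convex_halfSpace_lt (IsLinearMap.mk (by simp) (by simp)) 0
  have h₃ : Convex ℝ {p : ℝ × ℝ | 1 < p.1 + p.2} :=
    convex_halfSpace_gt (IsLinearMap.mk (fun x y => by simp; ring) fun c x => by simp; ring) 1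
  have : closedTriangleᶜ =
      ({p : ℝ × ℝ | p.1 < 0} ∪ {p | p.2 < 0}) ∪ {p | 1 < p.1 + p.2} := by
    ext p
    simp only [closedTriangle, Set.mem_compl_iff, Set.mem_ofPred_eq, Set.mem_union, not_and_or,
      not_le, or_assoc]
  rw [this]
  refine IsPreconnected.union (-1, 3) ?_ ?_
    (IsPreconnected.union (-1, -1) ?_ ?_ h₁.isPreconnected h₂.isPreconnected) h₃.isPreconnected <;>
  norm_num

/-- Only affinity is required of `ψ`, because the coordinates used for some faces move the origin.
-/
theorem triangleBoundary_preimage {ψ : ℝ × ℝ → ℝ × ℝ} (hψ : Function.Injective ψ)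
    (haff : ∀ p q (s t : ℝ), s + t = 1 → ψ (s • p + t • q) = s • ψ p + t • ψ q) (a b c : ℝ × ℝ) :
    ψ ⁻¹' triangleBoundary (ψ a) (ψ b) (ψ c) = triangleBoundary a b c := by
  have key : ∀ p q, ψ ⁻¹' segment ℝ (ψ p) (ψ q) = segment ℝ p q := by
    intro p q
    ext x
    constructor
    · rintro ⟨s, t, hs, ht, hst, h⟩
      exact ⟨s, t, hs, ht, hst, hψ ((haff p q s t hst).trans h)⟩
    · rintro ⟨s, t, hs, ht, hst, rfl⟩
      exact ⟨s, t, hs, ht, hst, (haff p q s t hst).symm⟩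
  simp only [triangleBoundary, Set.preimage_union, key]

end Triangle

/-! ### The straight-line drawing and its faces -/

section Drawing

/-- The positions of the vertices in a drawing: each new point is the centroid of the triangle
spanned by the origin and the two previous points. -/
noncomputable def conePos : ℕ → ℝ × ℝ
  | 0 => (0, 0)
  | 1 => (1, 0)
  | 2 => (0, 1)
  | k + 3 => (1 / 3 : ℝ) • (conePos (k + 1) + conePos (k + 2))

/-- The change of coordinates from one triangle to the next. -/
noncomputable def coneStep : (ℝ × ℝ) ≃L[ℝ] (ℝ × ℝ) :=
  ContinuousLinearEquiv.equivOfInverse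
    ((ContinuousLinearMap.snd ℝ ℝ ℝ - ContinuousLinearMap.fst ℝ ℝ ℝ).prod
      ((3 : ℝ) • ContinuousLinearMap.fst ℝ ℝ ℝ))
    (((1 / 3 : ℝ) • ContinuousLinearMap.snd ℝ ℝ ℝ).prod
      (ContinuousLinearMap.fst ℝ ℝ ℝ + (1 / 3 : ℝ) • ContinuousLinearMap.snd ℝ ℝ ℝ))
    (fun p => by ext <;> simp) (fun p => by ext <;> simp)

/-- Linear coordinates in which `conePos (j + 1)` and `conePos (j + 2)` are the unit vectors. -/
noncomputable def coneCoord : ℕ → (ℝ × ℝ) ≃L[ℝ] (ℝ × ℝ)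
  | 0 => .refl ℝ _
  | j + 1 => (coneCoord j).trans coneStep

theorem coneCoord_succ (j : ℕ) (p : ℝ × ℝ) :
    coneCoord (j + 1) p = ((coneCoord j p).2 - (coneCoord j p).1, 3 * (coneCoord j p).1) := rfl

theorem coneCoord_conePos_zero (j : ℕ) : coneCoord j (conePos 0) = (0, 0) :=
  map_zero (coneCoord j)

theorem coneCoord_conePos (j : ℕ) : coneCoord j (conePos (j + 1)) = (1, 0) ∧
    coneCoord j (conePos (j + 2)) = (0, 1) ∧ coneCoord j (conePos (j + 3)) = (1 / 3, 1 / 3) := by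
  have third : ∀ j, coneCoord j (conePos (j + 1)) = (1, 0) →
      coneCoord j (conePos (j + 2)) = (0, 1) →
      coneCoord j (conePos (j + 3)) = (1 / 3, 1 / 3) := by
    intro j h₁ h₂
    rw [conePos, map_smul, map_add, h₁, h₂]
    norm_num
  induction j with
  | zero => exact ⟨rfl, rfl, third 0 rfl rfl⟩
  | succ j ih =>
    have h₁ : coneCoord (j + 1) (conePos (j + 1 + 1)) = (1, 0) := by
      rw [coneCoord_succ, ih.2.1]; norm_num
    have h₂ : coneCoord (j + 1) (conePos (j + 1 + 2)) = (0, 1) := by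
      rw [coneCoord_succ, ih.2.2]; norm_num
    exact ⟨h₁, h₂, third _ h₁ h₂⟩

/-- A region containing the point `b` and the interiors of the edges from `b` to earlier points, but
meeting no edge between earlier points. -/
def coneZone : ℕ → Set (ℝ × ℝ)
  | 0 => Set.univ
  | 1 => {p | 0 < p.1}
  | 2 => {p | 0 < p.2}
  | j + 3 => coneCoord j ⁻¹' openTriangle

theorem mem_coneZone {j : ℕ} {p : ℝ × ℝ} : p ∈ coneZone (j + 3) ↔ 0 < (coneCoord j p).1 ∧
    0 < (coneCoord j p).2 ∧ (coneCoord j p).1 + (coneCoord j p).2 < 1 := Iff.rfl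

/-- From index `3` on the zones are nested triangles; the half-planes at `1` and `2` do not fit into
this chain. -/
theorem coneZone_antitone : AntitoneOn coneZone (Set.Ici 3) := by
  have h : Antitone fun j => coneZone (j + 3) := antitone_nat_of_succ_le fun j p hp => by
    simp only [mem_coneZone, coneCoord_succ] at hp ⊢
    exact ⟨by linarith, by linarith, by linarith⟩
  intro a ha b hb hab
  obtain ⟨a, rfl⟩ := Nat.exists_eq_add_of_le' ha
  obtain ⟨b, rfl⟩ := Nat.exists_eq_add_of_le' hb
  exact h (by omega : a ≤ b)

/-- Points of a segment in linear coordinates. -/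
theorem exists_coord_of_mem_segment (L : (ℝ × ℝ) ≃L[ℝ] (ℝ × ℝ)) {p q x : ℝ × ℝ}
    (hx : x ∈ segment ℝ p q) : ∃ s t : ℝ, 0 ≤ s ∧ 0 ≤ t ∧ s + t = 1 ∧ (t = 0 → x = p) ∧
      (s = 0 → x = q) ∧ (L x).1 = s * (L p).1 + t * (L q).1 ∧
      (L x).2 = s * (L p).2 + t * (L q).2 := by
  obtain ⟨s, t, hs, ht, hst, rfl⟩ := hx
  refine ⟨s, t, hs, ht, hst, fun h => ?_, fun h => ?_, by simp, by simp⟩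
  · obtain rfl : s = 1 := by linarith
    simp [h]
  · obtain rfl : t = 1 := by linarith
    simp [h]

/-- The pairs `a < b` of adjacent vertices. -/
def ConeEdge (a b : ℕ) : Prop := a < b ∧ (a = 0 ∨ b ≤ a + 2)

theorem ConeEdge.cases {a b : ℕ} (h : ConeEdge a b) : (a = 0 ∧ b = 1) ∨ (a = 0 ∧ b = 2) ∨
    (a = 1 ∧ b = 2) ∨ ∃ j, b = j + 3 ∧ (a = 0 ∨ a = j + 1 ∨ a = j + 2) := by
  obtain ⟨h₁, h₂⟩ := h
  rcases Nat.lt_or_ge b 3 with h₃ | h₃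
  · omega
  · exact Or.inr (Or.inr (Or.inr ⟨b - 3, by omega, by omega⟩))

/-- With `disjoint_coneZone`, this gives planarity: apart from its earlier end, an edge lives in the
zone of its later end, and that zone is free of all edges between earlier vertices. -/
theorem ConeEdge.segment_subset {a b : ℕ} (h : ConeEdge a b) :
    segment ℝ (conePos a) (conePos b) ⊆ insert (conePos a) (coneZone b) := by
  intro x hx
  rw [Set.mem_insert_iff, or_iff_not_imp_left]
  intro hne
  rcases h.cases with ⟨rfl, rfl⟩ | ⟨rfl, rfl⟩ | ⟨rfl, rfl⟩ | ⟨j, rfl, k⟩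
  any_goals
    obtain ⟨s, t, hs, ht, hst, h₀, -, h₁, h₂⟩ := exists_coord_of_mem_segment (.refl ℝ _) hx
    have ht' : 0 < t := ht.lt_of_ne fun e => hne (h₀ e.symm)
    simp only [ContinuousLinearEquiv.coe_refl', id_eq] at h₁ h₂
    simpa [conePos, coneZone, h₁, h₂] using ht'
  obtain ⟨s, t, hs, ht, hst, h₀, -, h₁, h₂⟩ := exists_coord_of_mem_segment (coneCoord j) hx
  have ht' : 0 < t := ht.lt_of_ne fun e => hne (h₀ e.symm)
  rw [mem_coneZone, h₁, h₂]
  rcases k with rfl | rfl | rfl <;>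
  simp only [coneCoord_conePos_zero, coneCoord_conePos] <;>
  exact ⟨by linarith, by linarith, by linarith⟩

theorem ConeEdge.disjoint_coneZone {a b c : ℕ} (h : ConeEdge a b) (hbc : b < c) :
    Disjoint (segment ℝ (conePos a) (conePos b)) (coneZone c) := by
  -- By monotonicity it is enough to test the first zone after `b` in the nested range. Below `3`
  -- the only possibility is `b = 1`, `c = 2`.
  suffices hs : Disjoint (segment ℝ (conePos a) (conePos b)) (coneZone (b + 1)) ∧
      Disjoint (segment ℝ (conePos a) (conePos b)) (coneZone (max (b + 1) 3)) by
    rcases Nat.lt_or_ge c 3 with hc | hc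
    · obtain rfl : c = b + 1 := by have := h.1; omega
      exact hs.1
    · exact hs.2.mono_right (coneZone_antitone (by simp) hc (by omega))
  simp only [Set.disjoint_left]
  rcases h.cases with ⟨rfl, rfl⟩ | ⟨rfl, rfl⟩ | ⟨rfl, rfl⟩ | ⟨j, rfl, k⟩
  any_goals
    constructor <;> intro x hx <;>
    obtain ⟨s, t, hs, ht, hst, -, -, h₁, h₂⟩ := exists_coord_of_mem_segment (.refl ℝ _) hx <;>
    simp [conePos] at h₁ h₂ <;>
    simp [coneZone, coneCoord, openTriangle, h₁, h₂] <;> intros <;> linarith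
  rw [show max (j + 3 + 1) 3 = j + 1 + 3 by omega, and_self]
  intro x hx hx'
  obtain ⟨s, t, hs, ht, hst, -, -, h₁, h₂⟩ := exists_coord_of_mem_segment (coneCoord j) hx
  rw [show j + 3 + 1 = j + 1 + 3 by omega, mem_coneZone, coneCoord_succ, h₁, h₂] at hx'
  rcases k with rfl | rfl | rfl <;>
  simp only [coneCoord_conePos_zero, coneCoord_conePos] at hx' <;>
  linarith [hx'.1, hx'.2.1, hx'.2.2]

theorem conePos_mem_coneZone (b : ℕ) : conePos b ∈ coneZone b := by
  match b with
  | 0 => trivial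
  | 1 => norm_num [conePos, coneZone]
  | 2 => norm_num [conePos, coneZone]
  | j + 3 =>
    rw [mem_coneZone, (coneCoord_conePos j).2.2]
    norm_num

theorem conePos_notMem_coneZone {b c : ℕ} (h : b < c) : conePos b ∉ coneZone c := by
  rcases Nat.eq_zero_or_pos b with rfl | hb
  · match c with
    | 0 => omega
    | 1 => norm_num [conePos, coneZone]
    | 2 => norm_num [conePos, coneZone]
    | j + 3 =>
      rw [mem_coneZone, coneCoord_conePos_zero]
      norm_num
  · have he : ConeEdge 0 b := ⟨hb, Or.inl rfl⟩
    exact Set.disjoint_left.1 (he.disjoint_coneZone h) (right_mem_segment ..)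

theorem conePos_injective : Function.Injective conePos := by
  intro a b h
  rcases lt_trichotomy a b with hab | hab | hab
  · exact absurd (h ▸ conePos_mem_coneZone b) (conePos_notMem_coneZone hab)
  · exact hab
  · exact absurd (h ▸ conePos_mem_coneZone a) (conePos_notMem_coneZone hab)

theorem ConeEdge.eq_or_eq_of_conePos_mem {a b c : ℕ} (h : ConeEdge a b)
    (hc : conePos c ∈ segment ℝ (conePos a) (conePos b)) : c = a ∨ c = b := by
  rcases lt_trichotomy c b with hcb | hcb | hcb
  · rcases h.segment_subset hc with hc | hc
    · exact Or.inl (conePos_injective hc)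
    · exact absurd hc (conePos_notMem_coneZone hcb)
  · exact Or.inr hcb
  · exact absurd (conePos_mem_coneZone c) (Set.disjoint_left.1 (h.disjoint_coneZone hcb) hc)

/-- If the later ends differ, the zones leave only the earlier end of the second edge as a meeting
point. If they agree, comparing coordinates shows that two edges into `b` meet only at `b`. -/
theorem ConeEdge.inter {a b a' b' : ℕ} (h : ConeEdge a b) (h' : ConeEdge a' b') (hb : b ≤ b')
    (hne : ¬(a = a' ∧ b = b')) {p : ℝ × ℝ} (hp : p ∈ segment ℝ (conePos a) (conePos b))
    (hp' : p ∈ segment ℝ (conePos a') (conePos b')) :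
    ∃ c, (c = a ∨ c = b) ∧ (c = a' ∨ c = b') ∧ p = conePos c := by
  rcases hb.lt_or_eq with hb | rfl
  · rcases h'.segment_subset hp' with rfl | hp'
    · exact ⟨a', h.eq_or_eq_of_conePos_mem hp, Or.inl rfl, rfl⟩
    · exact absurd hp' (Set.disjoint_left.1 (h.disjoint_coneZone hb) hp)
  · refine ⟨b, Or.inr rfl, Or.inr rfl, ?_⟩
    rcases h.cases with ⟨rfl, rfl⟩ | ⟨rfl, rfl⟩ | ⟨rfl, rfl⟩ | ⟨j, rfl, k⟩
    · have := h'.1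
      omega
    · obtain rfl : a' = 1 := by have := h'.1; omega
      obtain ⟨s, t, hs, ht, hst, -, h₀, h₁, h₂⟩ := exists_coord_of_mem_segment (coneCoord 0) hp
      obtain ⟨s', t', hs', ht', hst', -, -, h₁', h₂'⟩ :=
        exists_coord_of_mem_segment (coneCoord 0) hp'
      rw [h₁, coneCoord_conePos_zero, (coneCoord_conePos 0).1, (coneCoord_conePos 0).2.1] at h₁'
      rw [h₂, coneCoord_conePos_zero, (coneCoord_conePos 0).1, (coneCoord_conePos 0).2.1] at h₂'
      exact h₀ (by linarith)
    · obtain rfl : a' = 0 := by have := h'.1; omega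
      obtain ⟨s, t, hs, ht, hst, -, h₀, h₁, h₂⟩ := exists_coord_of_mem_segment (coneCoord 0) hp
      obtain ⟨s', t', hs', ht', hst', -, -, h₁', h₂'⟩ :=
        exists_coord_of_mem_segment (coneCoord 0) hp'
      rw [h₁, coneCoord_conePos_zero, (coneCoord_conePos 0).1, (coneCoord_conePos 0).2.1] at h₁'
      exact h₀ (by linarith)
    · obtain ⟨s, t, hs, ht, hst, -, h₀, h₁, h₂⟩ := exists_coord_of_mem_segment (coneCoord j) hp
      obtain ⟨s', t', hs', ht', hst', -, -, h₁', h₂'⟩ :=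
        exists_coord_of_mem_segment (coneCoord j) hp'
      have k' : a' = 0 ∨ a' = j + 1 ∨ a' = j + 2 := by have := h'.1; have := h'.2; omega
      rw [h₁] at h₁'
      rw [h₂] at h₂'
      apply h₀
      rcases k with rfl | rfl | rfl <;> rcases k' with rfl | rfl | rfl <;>
      first
        | exact absurd ⟨rfl, rfl⟩ hne
        | (simp only [coneCoord_conePos_zero, coneCoord_conePos] at h₁' h₂'
           linarith)

/-- The straight-line path from `a` to `b`. -/
noncomputable def segmentPath (a b : ℝ × ℝ) : Path a b where
  toFun t := AffineMap.lineMap a b (t : ℝ)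
  continuous_toFun := by
    simp only [AffineMap.lineMap_apply_module]
    fun_prop
  source' := by simp
  target' := by simp

theorem range_segmentPath (a b : ℝ × ℝ) : Set.range (segmentPath a b) = segment ℝ a b := by
  rw [segment_eq_image_lineMap]
  ext x
  constructor
  · rintro ⟨t, rfl⟩
    exact ⟨t, t.2, rfl⟩
  · rintro ⟨t, ht, rfl⟩
    exact ⟨⟨t, ht⟩, rfl⟩

theorem segmentPath_injective {a b : ℝ × ℝ} (h : a ≠ b) : Function.Injective (segmentPath a b) :=
  fun _ _ hst => Subtype.ext (AffineMap.lineMap_injective ℝ h hst)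

theorem squaredPathCone_adj_iff_coneEdge {n : ℕ} {u v : Fin n} :
    (squaredPathCone n).Adj u v ↔ ConeEdge u v ∨ ConeEdge v u := by
  rw [squaredPathCone_adj, ConeEdge, ConeEdge, ne_eq, Fin.ext_iff]
  omega

theorem exists_coneEdge_of_mem_edgeSet {n : ℕ} {e : Sym2 (Fin n)}
    (he : e ∈ (squaredPathCone n).edgeSet) : ∃ u v : Fin n, e = s(u, v) ∧ ConeEdge u v := by
  induction e using Sym2.ind with
  | h u v =>
    rcases squaredPathCone_adj_iff_coneEdge.1 he with h | h
    · exact ⟨u, v, rfl, h⟩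
    · exact ⟨v, u, Sym2.eq_swap, h⟩

/-- The straight-line drawing of the cone over a squared path. -/
noncomputable def coneDrawing (n : ℕ) : PlaneDrawing (squaredPathCone n) where
  pos u := conePos u
  arc := Sym2.lift ⟨fun u v => segment ℝ (conePos u) (conePos v), fun _ _ => segment_symm ..⟩
  pos_injective u v h := Fin.ext (conePos_injective h)
  arc_simple u v h := ⟨segmentPath _ _, segmentPath_injective fun e =>
    h.1 (Fin.ext (conePos_injective e)), range_segmentPath _ _⟩
  arc_vertex e he w hw := by
    obtain ⟨u, v, rfl, h⟩ := exists_coneEdge_of_mem_edgeSet he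
    rw [Sym2.lift_mk] at hw
    rw [Sym2.mem_iff, Fin.ext_iff, Fin.ext_iff]
    exact h.eq_or_eq_of_conePos_mem hw
  arc_inter e he e' he' hne p hp := by
    obtain ⟨u, v, rfl, h⟩ := exists_coneEdge_of_mem_edgeSet he
    obtain ⟨u', v', rfl, h'⟩ := exists_coneEdge_of_mem_edgeSet he'
    rw [Sym2.lift_mk, Sym2.lift_mk] at hp
    have hne' : ¬((u : ℕ) = u' ∧ (v : ℕ) = v') := fun k => hne (by
      rw [Fin.ext k.1, Fin.ext k.2])
    have fin : ∀ {c : ℕ} {x y : Fin n}, c = x ∨ c = y → c < n := by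
      rintro c x y (rfl | rfl) <;> exact Fin.is_lt _
    simp only [Sym2.mem_iff]
    rcases le_total (v : ℕ) v' with hv | hv
    · obtain ⟨c, hc, hc', rfl⟩ := h.inter h' hv hne' hp.1 hp.2
      exact ⟨⟨c, fin hc⟩, by simpa [Fin.ext_iff] using hc, by simpa [Fin.ext_iff] using hc', rfl⟩
    · obtain ⟨c, hc, hc', rfl⟩ := h'.inter h hv (fun k => hne' ⟨k.1.symm, k.2.symm⟩) hp.2 hp.1
      exact ⟨⟨c, fin hc⟩, by simpa [Fin.ext_iff] using hc', by simpa [Fin.ext_iff] using hc, rfl⟩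

theorem mem_coneDrawing_support {n : ℕ} (hn : 3 ≤ n) {p : ℝ × ℝ} :
    p ∈ (coneDrawing n).support ↔
      ∃ a b, ConeEdge a b ∧ b < n ∧ p ∈ segment ℝ (conePos a) (conePos b) := by
  constructor
  · rintro (⟨u, rfl⟩ | hp)
    · rcases Nat.eq_zero_or_pos u.val with hu | hu
      · exact ⟨0, 1, ⟨one_pos, Or.inl rfl⟩, by omega, by
          change conePos u ∈ _
          rw [hu]; exact left_mem_segment ..⟩
      · exact ⟨0, u, ⟨hu, Or.inl rfl⟩, u.2, right_mem_segment ..⟩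
    · simp only [Set.mem_iUnion] at hp
      obtain ⟨e, he, hp⟩ := hp
      obtain ⟨u, v, rfl, h⟩ := exists_coneEdge_of_mem_edgeSet he
      exact ⟨u, v, h, v.2, hp⟩
  · rintro ⟨a, b, h, hb, hp⟩
    refine Or.inr (Set.mem_iUnion₂.2 ⟨s(⟨a, h.1.trans hb⟩, ⟨b, hb⟩), ?_, hp⟩)
    exact squaredPathCone_adj_iff_coneEdge.2 (Or.inl h)

/-- Such an `F` is both open and closed relative to `S`, so a connected subset of `S` meeting `F`
cannot leave it. -/
theorem eq_of_isPreconnected_of_frontier_disjoint {X : Type*} [TopologicalSpace X] {S F : Set X}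
    (hF : IsOpen F) (hF' : IsPreconnected F) (hFS : F ⊆ S) (hfr : Disjoint (frontier F) S) {p : X}
    (hp : p ∈ F) : connectedComponentIn S p = F := by
  refine subset_antisymm (fun x hx => ?_) (hF'.subset_connectedComponentIn hp hFS)
  by_contra hxF
  have hcl : ∀ y ∈ connectedComponentIn S p, y ∈ closure F → y ∈ F := fun y hy hy' => by
    by_contra h
    exact Set.disjoint_left.1 hfr ⟨hy', fun k => h (interior_subset k)⟩
      (connectedComponentIn_subset _ _ hy)
  obtain ⟨y, -, hy, hy'⟩ := isPreconnected_connectedComponentIn F (closure F)ᶜ hF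
    isClosed_closure.isOpen_compl (fun y hy => or_iff_not_imp_right.2 fun h =>
      hcl y hy (Set.notMem_compl_iff.1 h))
    ⟨p, mem_connectedComponentIn (hFS hp), hp⟩ ⟨x, hx, fun hx' => hxF (hcl x hx hx')⟩
  exact hy' (subset_closure hy)

/-- A certificate for all faces alike: an affine `ψ` straightens the triangle, and `T` can be either
the open model triangle or, for the outer face, the complement of the closed one. -/
theorem coneDrawing_isBoundedByTriangle {n : ℕ} {u v w : Fin n} (huv : ConeEdge u v)
    (hvw : ConeEdge v w) (huw : ConeEdge u w) (ψ : ℝ × ℝ ≃ₜ ℝ × ℝ)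
    (haff : ∀ p q (s t : ℝ), s + t = 1 → ψ (s • p + t • q) = s • ψ p + t • ψ q)
    (hψ : triangleBoundary (ψ (conePos u)) (ψ (conePos v)) (ψ (conePos w)) =
      triangleBoundary (0, 0) (1, 0) (0, 1))
    {T : Set (ℝ × ℝ)} (hT : IsOpen T) (hT' : IsPreconnected T)
    (hfr : frontier T = triangleBoundary (0, 0) (1, 0) (0, 1))
    (hTS : ψ ⁻¹' T ⊆ (coneDrawing n).supportᶜ) {p : ℝ × ℝ} (hp : ψ p ∈ T) :
    (coneDrawing n).IsBoundedByTriangle (connectedComponentIn (coneDrawing n).supportᶜ p) := by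
  have huv' := squaredPathCone_adj_iff_coneEdge.2 (Or.inl huv)
  have hvw' := squaredPathCone_adj_iff_coneEdge.2 (Or.inl hvw)
  have hwu' := squaredPathCone_adj_iff_coneEdge.2 (Or.inr huw)
  have hfr' : frontier (ψ ⁻¹' T) = (coneDrawing n).arc s(u, v) ∪ (coneDrawing n).arc s(v, w) ∪
      (coneDrawing n).arc s(w, u) := by
    rw [← ψ.preimage_frontier, hfr, ← hψ, triangleBoundary_preimage ψ.injective haff]
    rfl
  rw [eq_of_isPreconnected_of_frontier_disjoint (hT.preimage ψ.continuous)
    (ψ.isPreconnected_preimage.2 hT') hTS ?_ hp]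
  · exact ⟨u, v, w, huv', hvw', hwu', hfr'⟩
  · rw [hfr', Set.disjoint_compl_right_iff_subset]
    refine Set.union_subset (Set.union_subset ?_ ?_) ?_ <;>
    refine fun x hx => Or.inr (Set.mem_iUnion₂.2 ⟨_, ?_, hx⟩) <;> assumption

theorem triangleBoundary_swap (a b c : ℝ × ℝ) :
    triangleBoundary b c a = triangleBoundary a b c := by
  simp only [triangleBoundary]
  ext x
  simp only [Set.mem_union]
  tauto

/-- Coordinates in which `(0, 0)`, `(1, 0)`, `(1/3, 1/3)` become `(0, 0)`, `(1, 0)`, `(0, 1)`. -/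
noncomputable def sideCoord : ℝ × ℝ ≃ₜ ℝ × ℝ where
  toFun p := (p.1 - p.2, 3 * p.2)
  invFun p := (p.1 + p.2 / 3, p.2 / 3)
  left_inv p := by ext <;> simp
  right_inv p := by ext <;> simp; ring
  continuous_toFun := by fun_prop
  continuous_invFun := by fun_prop

/-- Coordinates in which `(1, 0)`, `(0, 1)`, `(1/3, 1/3)` become `(1, 0)`, `(0, 1)`, `(0, 0)`. -/
noncomputable def baseCoord : ℝ × ℝ ≃ₜ ℝ × ℝ where
  toFun p := (2 * p.1 + p.2 - 1, p.1 + 2 * p.2 - 1)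
  invFun p := (1 / 3 + 2 * p.1 / 3 - p.2 / 3, 1 / 3 - p.1 / 3 + 2 * p.2 / 3)
  left_inv p := by ext <;> simp <;> ring
  right_inv p := by ext <;> simp <;> ring
  continuous_toFun := by fun_prop
  continuous_invFun := by fun_prop

theorem sideCoord_apply (p : ℝ × ℝ) : sideCoord p = (p.1 - p.2, 3 * p.2) := rfl

theorem baseCoord_apply (p : ℝ × ℝ) : baseCoord p = (2 * p.1 + p.2 - 1, p.1 + 2 * p.2 - 1) := rfl

theorem mem_segment_of_coord (L : (ℝ × ℝ) ≃L[ℝ] (ℝ × ℝ)) {p q x : ℝ × ℝ} {s t : ℝ} (hs : 0 ≤ s)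
    (ht : 0 ≤ t) (hst : s + t = 1) (h₁ : (L x).1 = s * (L p).1 + t * (L q).1)
    (h₂ : (L x).2 = s * (L p).2 + t * (L q).2) : x ∈ segment ℝ p q := by
  refine ⟨s, t, hs, ht, hst, L.injective ?_⟩
  rw [map_add, map_smul, map_smul]
  ext
  · simp [h₁]
  · simp [h₂]

/-- A point of an edge that lies in one triangle but not in the next one lies on an edge at the
point that subdivides the former triangle. -/
theorem ConeEdge.exists_edge_of_mem_of_notMem {j a b : ℕ} (h : ConeEdge a b) {q : ℝ × ℝ}
    (hq : q ∈ segment ℝ (conePos a) (conePos b)) (hj : q ∈ coneZone (j + 3))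
    (hj' : q ∉ coneZone (j + 4)) :
    ∃ c, ConeEdge c (j + 3) ∧ q ∈ segment ℝ (conePos c) (conePos (j + 3)) := by
  rcases lt_trichotomy b (j + 3) with hb | rfl | hb
  · exact absurd hj (Set.disjoint_left.1 (h.disjoint_coneZone hb) hq)
  · exact ⟨a, h, hq⟩
  · have later : ∀ {c}, j + 3 < c → coneZone c ⊆ coneZone (j + 4) := fun hc =>
      coneZone_antitone (by simp) (by simp; omega) hc
    rcases h.segment_subset hq with rfl | hq
    · rcases lt_trichotomy a (j + 3) with ha | rfl | ha
      · exact absurd hj (conePos_notMem_coneZone ha)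
      · exact ⟨0, ⟨by omega, Or.inl rfl⟩, right_mem_segment ..⟩
      · exact absurd (later ha (conePos_mem_coneZone a)) hj'
    · exact absurd (later hb hq) hj'

/-- The three edges from `j + 3` to the corners cut the triangle into three. One part is the next
zone; the others are the faces `0`, `j + 1`, `j + 3` (`sideCoord`) and `j + 1`, `j + 2`, `j + 3`
(`baseCoord`). -/
theorem coneDrawing_isBoundedByTriangle_of_mem {n j : ℕ} (hj : j + 3 < n) {p : ℝ × ℝ}
    (hp : p ∉ (coneDrawing n).support) (hpj : p ∈ coneZone (j + 3)) (hpj' : p ∉ coneZone (j + 4)) :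
    (coneDrawing n).IsBoundedByTriangle (connectedComponentIn (coneDrawing n).supportᶜ p) := by
  have hn : 3 ≤ n := by omega
  have e₀ : ConeEdge 0 (j + 3) := ⟨by omega, Or.inl rfl⟩
  have e₁ : ConeEdge (j + 1) (j + 3) := ⟨by omega, Or.inr le_rfl⟩
  have e₂ : ConeEdge (j + 2) (j + 3) := ⟨by omega, Or.inr (by omega)⟩
  have e₃ : ConeEdge (j + 1) (j + 2) := ⟨by omega, Or.inr (by omega)⟩
  have e₄ : ConeEdge 0 (j + 1) := ⟨by omega, Or.inl rfl⟩
  obtain ⟨c₁, c₂, c₃⟩ := coneCoord_conePos j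
  have c₀ := coneCoord_conePos_zero j
  have avoid : ∀ {q a}, ConeEdge a (j + 3) → q ∈ segment ℝ (conePos a) (conePos (j + 3)) →
      ¬ sideCoord (coneCoord j q) ∈ openTriangle ∧ ¬ baseCoord (coneCoord j q) ∈ openTriangle := by
    intro q a ha hq
    obtain ⟨s, t, hs, ht, hst, -, -, h₁, h₂⟩ := exists_coord_of_mem_segment (coneCoord j) hq
    have ha' : a = 0 ∨ a = j + 1 ∨ a = j + 2 := by have := ha.1; have := ha.2; omega
    rw [sideCoord_apply, baseCoord_apply, openTriangle, h₁, h₂]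
    rcases ha' with rfl | rfl | rfl <;> simp only [c₀, c₁, c₂, c₃] <;> constructor <;>
    rintro ⟨k₁, k₂, k₃⟩ <;> simp only at k₁ k₂ k₃ <;> linarith
  have hseg : ∀ {a}, ConeEdge a (j + 3) → p ∉ segment ℝ (conePos a) (conePos (j + 3)) :=
    fun ha h => hp ((mem_coneDrawing_support hn).2 ⟨_, _, ha, hj, h⟩)
  have hside : (fun q => sideCoord (coneCoord j q)) ⁻¹' openTriangle ⊆
      (coneDrawing n).supportᶜ := by
    intro q hq hq'
    obtain ⟨a, b, hab, hb, hq'⟩ := (mem_coneDrawing_support hn).1 hq'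
    obtain ⟨k₁, k₂, k₃⟩ := id hq
    simp only [sideCoord_apply] at k₁ k₂ k₃
    obtain ⟨c, hc, hqc⟩ := hab.exists_edge_of_mem_of_notMem (j := j) hq'
      (mem_coneZone.2 ⟨by linarith, by linarith, by linarith⟩) (fun h => by
        have := (mem_coneZone.1 h).1
        rw [coneCoord_succ] at this
        linarith)
    exact (avoid hc hqc).1 hq
  have hbase : (fun q => baseCoord (coneCoord j q)) ⁻¹' openTriangle ⊆
      (coneDrawing n).supportᶜ := by
    intro q hq hq'
    obtain ⟨a, b, hab, hb, hq'⟩ := (mem_coneDrawing_support hn).1 hq'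
    obtain ⟨k₁, k₂, k₃⟩ := id hq
    simp only [baseCoord_apply] at k₁ k₂ k₃
    obtain ⟨c, hc, hqc⟩ := hab.exists_edge_of_mem_of_notMem (j := j) hq'
      (mem_coneZone.2 ⟨by linarith, by linarith, by linarith⟩) (fun h => by
        have := (mem_coneZone.1 h).2.2
        rw [coneCoord_succ] at this
        linarith)
    exact (avoid hc hqc).2 hq
  have hcases : sideCoord (coneCoord j p) ∈ openTriangle ∨
      baseCoord (coneCoord j p) ∈ openTriangle := by
    have hm := mem_coneZone.1 hpj
    have hm' : ¬ _ := fun h => hpj' (mem_coneZone.2 h)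
    rw [coneCoord_succ] at hm'
    -- Since `p` is off the drawing, it is on none of the three edges to the centroid. These lie on
    -- the lines `x = y`, `x + 2y = 1` and `2x + y = 1`, which the case split below compares with
    -- `p`.
    have t₀ : ∀ s t : ℝ, 0 ≤ s → 0 ≤ t → s + t = 1 → (coneCoord j p).1 = t / 3 →
        (coneCoord j p).2 = t / 3 → False := fun s t hs ht hst h h' => hseg e₀
      (mem_segment_of_coord (coneCoord j) hs ht hst (by rw [c₀, c₃, h]; ring)
        (by rw [c₀, c₃, h']; ring))
    have t₁ : ∀ s t : ℝ, 0 ≤ s → 0 ≤ t → s + t = 1 → (coneCoord j p).1 = s + t / 3 →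
        (coneCoord j p).2 = t / 3 → False := fun s t hs ht hst h h' => hseg e₁
      (mem_segment_of_coord (coneCoord j) hs ht hst (by rw [c₁, c₃, h]; ring)
        (by rw [c₁, c₃, h']; ring))
    have t₂ : ∀ s t : ℝ, 0 ≤ s → 0 ≤ t → s + t = 1 → (coneCoord j p).1 = t / 3 →
        (coneCoord j p).2 = s + t / 3 → False := fun s t hs ht hst h h' => hseg e₂
      (mem_segment_of_coord (coneCoord j) hs ht hst (by rw [c₂, c₃, h]; ring)
        (by rw [c₂, c₃, h']; ring))
    rw [sideCoord_apply, baseCoord_apply]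
    generalize coneCoord j p = r at *
    obtain ⟨x, y⟩ := r
    simp only at hm hm' t₀ t₁ t₂
    obtain ⟨hx, hy, hxy⟩ := hm
    simp only [openTriangle, Set.mem_ofPred_eq]
    rcases le_or_gt y x with h | h
    · rcases lt_trichotomy (x + 2 * y) 1 with h' | h' | h'
      · rcases h.eq_or_lt with rfl | h
        · exact (t₀ (1 - 3 * y) (3 * y) (by linarith) (by linarith) (by ring) (by ring)
            (by ring)).elim
        · exact Or.inl ⟨by linarith, by linarith, by linarith⟩
      · exact (t₁ (1 - 3 * y) (3 * y) (by linarith) (by linarith) (by ring) (by linarith)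
          (by ring)).elim
      · exact Or.inr ⟨by linarith, by linarith, by linarith⟩
    · rcases lt_trichotomy (2 * x + y) 1 with h' | h' | h'
      · exact (hm' ⟨by linarith, by linarith, by linarith⟩).elim
      · exact (t₂ (1 - 3 * x) (3 * x) (by linarith) (by linarith) (by ring) (by ring)
          (by linarith)).elim
      · exact Or.inr ⟨by linarith, by linarith, by linarith⟩
  rcases hcases with h | h
  · refine coneDrawing_isBoundedByTriangle (u := ⟨0, by omega⟩) (v := ⟨j + 1, by omega⟩)
      (w := ⟨j + 3, hj⟩) e₄ e₁ e₀ ((coneCoord j).toHomeomorph.trans sideCoord) ?_ ?_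
      isOpen_openTriangle convex_openTriangle.isPreconnected frontier_openTriangle hside h
    · intro p q s t hst
      simp only [Homeomorph.trans_apply, ContinuousLinearEquiv.coe_toHomeomorph, map_add, map_smul,
        sideCoord_apply]
      ext <;> simp <;> ring
    · simp only [Homeomorph.trans_apply, ContinuousLinearEquiv.coe_toHomeomorph, c₀, c₁, c₃,
        sideCoord_apply]
      norm_num
  · refine coneDrawing_isBoundedByTriangle (u := ⟨j + 1, by omega⟩) (v := ⟨j + 2, by omega⟩)
      (w := ⟨j + 3, hj⟩) e₃ e₂ e₁ ((coneCoord j).toHomeomorph.trans baseCoord) ?_ ?_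
      isOpen_openTriangle convex_openTriangle.isPreconnected frontier_openTriangle hbase h
    · intro p q s t hst
      obtain rfl : s = 1 - t := by linarith
      simp only [Homeomorph.trans_apply, ContinuousLinearEquiv.coe_toHomeomorph, map_add, map_smul,
        baseCoord_apply]
      ext <;> simp <;> ring
    · rw [← triangleBoundary_swap (0, 0)]
      simp only [Homeomorph.trans_apply, ContinuousLinearEquiv.coe_toHomeomorph, c₁, c₂, c₃,
        baseCoord_apply]
      norm_num

/-- A point off the drawing is outside the largest triangle, inside the smallest one, or in some
triangle of the nested sequence but not in the next. -/
theorem squaredPathCone_isTriangulatedPlanar {n : ℕ} (hn : 3 ≤ n) :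
    IsTriangulatedPlanar (squaredPathCone n) := by
  refine ⟨coneDrawing n, ?_⟩
  rintro F ⟨p, hp, rfl⟩
  have e₁ : ConeEdge 0 1 := ⟨by omega, by omega⟩
  have e₂ : ConeEdge 0 2 := ⟨by omega, by omega⟩
  have e₃ : ConeEdge 1 2 := ⟨by omega, by omega⟩
  have hclosed : ∀ k, conePos k ∈ closedTriangle := by
    intro k
    match k with
    | 0 => norm_num [conePos, closedTriangle]
    | 1 => norm_num [conePos, closedTriangle]
    | 2 => norm_num [conePos, closedTriangle]
    | k + 3 =>
      obtain ⟨h₁, h₂, h₃⟩ := coneZone_antitone (by simp) (by simp) (by omega : 3 ≤ k + 3)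
        (conePos_mem_coneZone (k + 3))
      exact ⟨h₁.le, h₂.le, h₃.le⟩
  by_cases hpK : p ∈ closedTriangle
  · have hpΔ : p ∈ coneZone (0 + 3) := by
      change p ∈ openTriangle
      by_contra h
      have : p ∈ frontier openTriangle := by
        rw [frontier, closure_openTriangle, isOpen_openTriangle.interior_eq]
        exact ⟨hpK, h⟩
      rw [frontier_openTriangle] at this
      refine hp ((mem_coneDrawing_support hn).2 ?_)
      rcases this with (h | h) | h
      · exact ⟨0, 1, e₁, by omega, h⟩
      · exact ⟨1, 2, e₃, by omega, h⟩
      · exact ⟨0, 2, e₂, by omega, segment_symm ℝ (conePos 2) (conePos 0) ▸ h⟩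
    -- Zone `n` is the triangle `0`, `n - 2`, `n - 1`, which would receive the nonexistent vertex
    -- `n` and hence is a face.
    by_cases hlast : p ∈ coneZone (n - 3 + 3)
    · obtain ⟨m, rfl⟩ := Nat.exists_eq_add_of_le' hn
      rw [Nat.add_sub_cancel] at hlast
      obtain ⟨c₁, c₂, -⟩ := coneCoord_conePos m
      refine coneDrawing_isBoundedByTriangle (u := ⟨0, by omega⟩) (v := ⟨m + 1, by omega⟩)
        (w := ⟨m + 2, by omega⟩) ⟨by simp, Or.inl rfl⟩ ⟨by simp, by simp⟩ ⟨by simp, Or.inl rfl⟩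
        (coneCoord m).toHomeomorph ?_ ?_ isOpen_openTriangle convex_openTriangle.isPreconnected
        frontier_openTriangle ?_ hlast
      · intro p q s t _
        simp
      · simp only [ContinuousLinearEquiv.coe_toHomeomorph, coneCoord_conePos_zero, c₁, c₂]
      · intro q hq hq'
        obtain ⟨a, b, hab, hb, hq'⟩ := (mem_coneDrawing_support hn).1 hq'
        exact Set.disjoint_left.1 (hab.disjoint_coneZone hb) hq' hq
    · obtain ⟨j, hj, h₁, h₂⟩ : ∃ j < n - 3, p ∈ coneZone (j + 3) ∧ p ∉ coneZone (j + 1 + 3) := by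
        by_contra! h
        have : ∀ j ≤ n - 3, p ∈ coneZone (j + 3) := by
          intro j
          induction j with
          | zero => exact fun _ => hpΔ
          | succ j ih => exact fun hj => h j hj (ih (by omega))
        exact hlast (this _ le_rfl)
      exact coneDrawing_isBoundedByTriangle_of_mem (by omega) hp h₁ h₂
  · refine coneDrawing_isBoundedByTriangle (u := ⟨0, by omega⟩) (v := ⟨1, by omega⟩)
      (w := ⟨2, by omega⟩) e₁ e₃ e₂ (.refl _) (by simp) rfl
      isClosed_closedTriangle.isOpen_compl isPreconnected_compl_closedTriangle
      frontier_compl_closedTriangle ?_ hpK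
    intro q hq hq'
    obtain ⟨a, b, hab, hb, hq'⟩ := (mem_coneDrawing_support hn).1 hq'
    have hconv : Convex ℝ closedTriangle := closure_openTriangle ▸ convex_openTriangle.closure
    exact hq (hconv.segment_subset (hclosed a) (hclosed b) hq')

end Drawing

/-! ### Upper bounds: two explicit labellings -/

section Representations

theorem gridGraph_adj {W H : ℕ} {p q : Fin W × Fin H} : (gridGraph W H).Adj p q ↔
    (p.1 = q.1 ∧ (p.2.val + 1 = q.2.val ∨ q.2.val + 1 = p.2.val)) ∨
      (p.2 = q.2 ∧ (p.1.val + 1 = q.1.val ∨ q.1.val + 1 = p.1.val)) := by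
  rw [gridGraph, SimpleGraph.boxProd_adj, SimpleGraph.pathGraph_adj, SimpleGraph.pathGraph_adj]
  tauto

/-- A set is connected if from each of its vertices a shorter step towards `b` is possible. -/
theorem SimpleGraph.induce_connected_of_descent {V : Type*} {G : SimpleGraph V} {S : Set V} {b : V}
    (hb : b ∈ S) (μ : V → ℕ)
    (h : ∀ p ∈ S, p ≠ b → ∃ q ∈ S, G.Adj p q ∧ μ q < μ p) : (G.induce S).Connected := by
  have key : ∀ k, ∀ p (hp : p ∈ S), μ p ≤ k → (G.induce S).Reachable ⟨p, hp⟩ ⟨b, hb⟩ := by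
    intro k
    induction k with
    | zero =>
      intro p hp hk
      rcases eq_or_ne p b with rfl | hne
      · exact .rfl
      · obtain ⟨q, -, -, hq⟩ := h p hp hne
        omega
    | succ k ih =>
      intro p hp hk
      rcases eq_or_ne p b with rfl | hne
      · exact .rfl
      · obtain ⟨q, hqS, hpq, hq⟩ := h p hp hne
        have hadj : (G.induce S).Adj ⟨p, hp⟩ ⟨q, hqS⟩ := hpq
        exact hadj.reachable.trans (ih q hqS (by omega))
  have : Nonempty S := ⟨⟨b, hb⟩⟩
  exact ⟨fun p q => (key _ p p.2 le_rfl).trans (key _ q q.2 le_rfl).symm⟩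

theorem isGridRepresentation_of_coneEdge {n W H : ℕ} {label : Fin W × Fin H → Fin n}
    (hconn : ∀ v, ((gridGraph W H).induce {p | label p = v}).Connected)
    (hedge : ∀ v w : Fin n, ConeEdge v w →
      ∃ p q, (gridGraph W H).Adj p q ∧ label p = v ∧ label q = w) :
    IsGridRepresentation (squaredPathCone n) label where
  surjective v := by
    obtain ⟨p, hp⟩ := (hconn v).nonempty
    exact ⟨p, hp⟩
  connected := hconn
  edge v w h := by
    rcases squaredPathCone_adj_iff_coneEdge.1 h with h | h
    · exact hedge v w h
    · obtain ⟨p, q, hpq, hp, hq⟩ := hedge w v h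
      exact ⟨q, p, hpq.symm, hq, hp⟩

/-- The labelling of a grid of height `4`: the vertex `0` surrounds two rows that hold the even and
the odd vertices of the path. -/
def lowConeLabel (m : ℕ) (p : Fin m × Fin 4) : Fin (m + 1) :=
  if h : p.1.val = 0 ∨ p.2.val = 0 ∨ p.2.val = 3 then 0
  else if p.2.val = 1 then ⟨1 + 2 * (p.1.val / 2), by omega⟩
  else ⟨2 + 2 * ((p.1.val - 1) / 2), by omega⟩

theorem lowConeLabel_val (m : ℕ) (p : Fin m × Fin 4) : (lowConeLabel m p).val =
    if p.1.val = 0 ∨ p.2.val = 0 ∨ p.2.val = 3 then 0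
    else if p.2.val = 1 then 1 + 2 * (p.1.val / 2) else 2 + 2 * ((p.1.val - 1) / 2) := by
  unfold lowConeLabel
  split_ifs <;> rfl

theorem lowConeLabel_eq {m x y : ℕ} {k : Fin (m + 1)} (hx : x < m) (hy : y < 4)
    (h : (if x = 0 ∨ y = 0 ∨ y = 3 then 0
      else if y = 1 then 1 + 2 * (x / 2) else 2 + 2 * ((x - 1) / 2)) = k.val) :
    lowConeLabel m (⟨x, hx⟩, ⟨y, hy⟩) = k :=
  Fin.ext ((lowConeLabel_val m _).trans h)

/-- A path vertex `v` occupies columns `v - 1` and `v` of its row, as far as they exist and are not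
column `0`. So `v` is above or below `v + 1` in column `v`, and its right neighbour there is `v +
2`. -/
theorem isGridRepresentation_lowConeLabel {m : ℕ} (hm : 2 ≤ m) :
    IsGridRepresentation (squaredPathCone (m + 1)) (lowConeLabel m) := by
  refine isGridRepresentation_of_coneEdge (fun v => ?_) fun v w h => ?_
  · rcases Nat.eq_zero_or_pos v.val with hv | hv
    · refine SimpleGraph.induce_connected_of_descent (b := (⟨0, by omega⟩, ⟨0, by omega⟩))
        (lowConeLabel_eq _ _ (by simp [hv])) (fun p => p.1.val + p.2.val) ?_
      rintro ⟨⟨x, hx⟩, ⟨y, hy⟩⟩ hp hne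
      have hp' := (lowConeLabel_val m _).symm.trans (congrArg Fin.val hp)
      simp only [ne_eq, Prod.mk.injEq, Fin.mk.injEq] at hp' hne
      rcases Nat.eq_zero_or_pos x with hx0 | hx0
      · refine ⟨(⟨x, hx⟩, ⟨y - 1, by omega⟩), lowConeLabel_eq _ _ (by simp [hx0, hv]),
          gridGraph_adj.2 (Or.inl ⟨rfl, ?_⟩), ?_⟩ <;> simp only <;> omega
      · have hy' : y = 0 ∨ y = 3 := by
          split_ifs at hp' <;> omega
        refine ⟨(⟨x - 1, by omega⟩, ⟨y, hy⟩), lowConeLabel_eq _ _ (by simp [hy', hv]),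
          gridGraph_adj.2 (Or.inr ⟨rfl, ?_⟩), ?_⟩ <;> simp only <;> omega
    · refine SimpleGraph.induce_connected_of_descent
        (b := (⟨max (v.val - 1) 1, by omega⟩, ⟨1 + (v.val - 1) % 2, by omega⟩))
        (lowConeLabel_eq _ _ (by split_ifs <;> omega)) (fun p => p.1.val) ?_
      rintro ⟨⟨x, hx⟩, ⟨y, hy⟩⟩ hp hne
      have hp' := (lowConeLabel_val m _).symm.trans (congrArg Fin.val hp)
      simp only [ne_eq, Prod.mk.injEq, Fin.mk.injEq] at hp' hne
      refine ⟨(⟨x - 1, by omega⟩, ⟨y, hy⟩), lowConeLabel_eq _ _ ?_,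
          gridGraph_adj.2 (Or.inr ⟨rfl, ?_⟩), ?_⟩ <;> (try simp only) <;>
        split_ifs at hp' ⊢ <;> omega
  · obtain ⟨h₁, h₂⟩ := h
    have hv' := v.2
    have hw' := w.2
    rcases Nat.eq_zero_or_pos v.val with hv | hv
    · exact ⟨(⟨max (w.val - 1) 1, by omega⟩, ⟨3 * ((w.val - 1) % 2), by omega⟩),
        (⟨max (w.val - 1) 1, by omega⟩, ⟨1 + (w.val - 1) % 2, by omega⟩),
        gridGraph_adj.2 (Or.inl ⟨rfl, by simp only; omega⟩),
        lowConeLabel_eq _ _ (by split_ifs <;> omega), lowConeLabel_eq _ _ (by split_ifs <;> omega)⟩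
    · rcases Nat.lt_or_ge (v.val + 1) w.val with hw | hw
      · exact ⟨(⟨v.val, by omega⟩, ⟨1 + (v.val - 1) % 2, by omega⟩),
          (⟨v.val + 1, by omega⟩, ⟨1 + (v.val - 1) % 2, by omega⟩),
          gridGraph_adj.2 (Or.inr ⟨rfl, Or.inl rfl⟩),
          lowConeLabel_eq _ _ (by split_ifs <;> omega),
          lowConeLabel_eq _ _ (by rw [if_neg (by omega)]; split_ifs <;> omega)⟩
      · exact ⟨(⟨v.val, by omega⟩, ⟨1 + (v.val - 1) % 2, by omega⟩),
          (⟨v.val, by omega⟩, ⟨1 + v.val % 2, by omega⟩),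
          gridGraph_adj.2 (Or.inl ⟨rfl, by simp only; omega⟩),
          lowConeLabel_eq _ _ (by split_ifs <;> omega),
          lowConeLabel_eq _ _ (by split_ifs <;> omega)⟩

theorem gridMajorHeight_squaredPathCone_le {n : ℕ} (hn : 3 ≤ n) :
    gridMajorHeight (squaredPathCone n) ≤ 4 := by
  obtain ⟨m, rfl⟩ := Nat.exists_eq_add_of_le' (by omega : 1 ≤ n)
  exact iInf₂_le 4 ⟨m, lowConeLabel m, isGridRepresentation_lowConeLabel (by omega)⟩

/-- A labelling in which the vertex `0` fills the last row and the path vertices are nested. -/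
def nestedConeLabel (m : ℕ) (p : Fin (2 * m) × Fin (m + 1)) : Fin (m + 1) :=
  if h : p.2.val = m then 0
  else ⟨1 + min (min (2 * p.1.val) (4 * m - 1 - 2 * p.1.val)) p.2.val, by omega⟩

theorem nestedConeLabel_val (m : ℕ) (p : Fin (2 * m) × Fin (m + 1)) :
    (nestedConeLabel m p).val = if p.2.val = m then 0
      else 1 + min (min (2 * p.1.val) (4 * m - 1 - 2 * p.1.val)) p.2.val := by
  unfold nestedConeLabel
  split_ifs <;> rfl

theorem nestedConeLabel_eq {m x y : ℕ} {k : Fin (m + 1)} (hx : x < 2 * m) (hy : y < m + 1)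
    (h : (if y = m then 0 else 1 + min (min (2 * x) (4 * m - 1 - 2 * x)) y) = k.val) :
    nestedConeLabel m (⟨x, hx⟩, ⟨y, hy⟩) = k :=
  Fin.ext ((nestedConeLabel_val m _).trans h)

/-- Going up a column, path labels increase from `1` to a cap and then repeat it until the apex row.
Caps are the odd labels from the left and the even ones from the right, truncated at `m`. Thus row
`m - 1` shows every `v` next to `v + 2` and below the apex, while the middle column shows `1, …, m`
in order. -/
theorem isSimpleGridRepresentation_nestedConeLabel {m : ℕ} (hm : 2 ≤ m) :
    IsSimpleGridRepresentation (squaredPathCone (m + 1)) (nestedConeLabel m) := by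
  refine ⟨isGridRepresentation_of_coneEdge (fun v => ?_) fun v w h => ?_, fun c v => ?_⟩
  · refine SimpleGraph.induce_connected_of_descent
      (b := (⟨m, by omega⟩, ⟨if v.val = 0 then m else v.val - 1, by split_ifs <;> omega⟩))
      (nestedConeLabel_eq _ _ (by split_ifs <;> omega))
      (fun p => p.2.val + ((p.1.val - m) + (m - p.1.val))) ?_
    rintro ⟨⟨x, hx⟩, ⟨y, hy⟩⟩ hp hne
    have hp' := (nestedConeLabel_val m _).symm.trans (congrArg Fin.val hp)
    simp only [ne_eq, Prod.mk.injEq, Fin.mk.injEq] at hp' hne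
    by_cases hy' : v.val ≠ 0 ∧ v.val - 1 < y
    · refine ⟨(⟨x, hx⟩, ⟨y - 1, by omega⟩), nestedConeLabel_eq _ _ ?_,
        gridGraph_adj.2 (Or.inl ⟨rfl, ?_⟩), ?_⟩ <;> (try simp only) <;>
        split_ifs at hp' hne ⊢ <;> omega
    · rcases Nat.lt_or_ge x m with hxm | hxm
      · refine ⟨(⟨x + 1, by omega⟩, ⟨y, hy⟩), nestedConeLabel_eq _ _ ?_,
          gridGraph_adj.2 (Or.inr ⟨rfl, Or.inl rfl⟩), ?_⟩ <;> (try simp only) <;>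
          split_ifs at hp' hne ⊢ <;> omega
      · refine ⟨(⟨x - 1, by omega⟩, ⟨y, hy⟩), nestedConeLabel_eq _ _ ?_,
          gridGraph_adj.2 (Or.inr ⟨rfl, ?_⟩), ?_⟩ <;> (try simp only) <;>
          split_ifs at hp' hne ⊢ <;> omega
  · obtain ⟨h₁, h₂⟩ := h
    have hv' := v.2
    have hw' := w.2
    rcases Nat.eq_zero_or_pos v.val with hv | hv
    · exact ⟨(⟨if w.val % 2 = 1 then (w.val - 1) / 2 else 2 * m - 1 - (w.val - 1) / 2, by
            split_ifs <;> omega⟩, ⟨m, by omega⟩),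
        (⟨if w.val % 2 = 1 then (w.val - 1) / 2 else 2 * m - 1 - (w.val - 1) / 2, by
            split_ifs <;> omega⟩, ⟨m - 1, by omega⟩),
        gridGraph_adj.2 (Or.inl ⟨rfl, by simp only; omega⟩),
        nestedConeLabel_eq _ _ (by simp [hv]), nestedConeLabel_eq _ _ (by split_ifs <;> omega)⟩
    · rcases Nat.lt_or_ge (v.val + 1) w.val with hw | hw
      · exact ⟨(⟨if v.val % 2 = 1 then (v.val - 1) / 2 else 2 * m - 1 - (v.val - 1) / 2, by
              split_ifs <;> omega⟩, ⟨m - 1, by omega⟩),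
          (⟨if v.val % 2 = 1 then (v.val - 1) / 2 + 1 else 2 * m - 2 - (v.val - 1) / 2, by
              split_ifs <;> omega⟩, ⟨m - 1, by omega⟩),
          gridGraph_adj.2 (Or.inr ⟨rfl, by simp only; split_ifs <;> omega⟩),
          nestedConeLabel_eq _ _ (by split_ifs <;> omega),
          nestedConeLabel_eq _ _ (by split_ifs <;> omega)⟩
      · exact ⟨(⟨m, by omega⟩, ⟨v.val - 1, by omega⟩), (⟨m, by omega⟩, ⟨v.val, by omega⟩),
          gridGraph_adj.2 (Or.inl ⟨rfl, by simp only; omega⟩),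
          nestedConeLabel_eq _ _ (by split_ifs <;> omega),
          nestedConeLabel_eq _ _ (by split_ifs <;> omega)⟩
  · rcases Set.eq_empty_or_nonempty {p | p.1 = c ∧ nestedConeLabel m p = v} with hS | ⟨p₀, hp₀⟩
    · rw [hS]
      exact fun p => p.2.elim
    · have hp₀' := (nestedConeLabel_val m _).symm.trans (congrArg Fin.val hp₀.2)
      rw [hp₀.1] at hp₀'
      refine (SimpleGraph.induce_connected_of_descent (G := gridGraph (2 * m) (m + 1))
        (S := {p | p.1 = c ∧ nestedConeLabel m p = v})
        (b := (c, ⟨if v.val = 0 then m else v.val - 1, by split_ifs <;> omega⟩))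
        ⟨rfl, nestedConeLabel_eq _ _ (by split_ifs at hp₀' ⊢ <;> omega)⟩
        (fun p => p.2.val) ?_).preconnected
      rintro ⟨⟨x, hx⟩, ⟨y, hy⟩⟩ ⟨rfl, hp⟩ hne
      have hp' := (nestedConeLabel_val m _).symm.trans (congrArg Fin.val hp)
      simp only [ne_eq, Prod.mk.injEq, Fin.mk.injEq, true_and] at hp' hne
      refine ⟨(⟨x, hx⟩, ⟨y - 1, by omega⟩), ⟨rfl, nestedConeLabel_eq _ _ ?_⟩,
        gridGraph_adj.2 (Or.inl ⟨rfl, ?_⟩), ?_⟩ <;> (try simp only) <;>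
        split_ifs at hp' hne ⊢ <;> omega

theorem exists_simpleGridMajorHeight_eq {n : ℕ} (hn : 3 ≤ n) :
    ∃ h W : ℕ, simpleGridMajorHeight (squaredPathCone n) = (h : ℕ∞) ∧
      ∃ label : Fin W × Fin h → Fin n,
        IsSimpleGridRepresentation (squaredPathCone n) label := by
  classical
  obtain ⟨m, rfl⟩ := Nat.exists_eq_add_of_le' (by omega : 1 ≤ n)
  have hex : ∃ h W : ℕ, ∃ label : Fin W × Fin h → Fin (m + 1),
      IsSimpleGridRepresentation (squaredPathCone (m + 1)) label :=
    ⟨_, _, nestedConeLabel m, isSimpleGridRepresentation_nestedConeLabel (by omega)⟩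
  obtain ⟨W, hW⟩ := Nat.find_spec hex
  refine ⟨Nat.find hex, W, le_antisymm (iInf₂_le _ ⟨W, hW⟩) (le_iInf₂ fun h hh => ?_), hW⟩
  exact_mod_cast Nat.find_min' hex hh

end Representations

/-! ### Connected sets and tripods in graphs -/

/-- Any two points of `S` are joined by a walk of `G` inside `S`. -/
def WalkConnected {V : Type*} (G : SimpleGraph V) (S : Set V) : Prop :=
  ∀ p ∈ S, ∀ q ∈ S, ∃ w : G.Walk p q, ∀ x ∈ w.support, x ∈ S

/-- Some edge of `G` joins `S` to `T`. -/
def SetsAdjacent {V : Type*} (G : SimpleGraph V) (S T : Set V) : Prop :=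
  ∃ p ∈ S, ∃ q ∈ T, G.Adj p q

section Walks

variable {V : Type*} {G : SimpleGraph V}

theorem SetsAdjacent.symm {S T : Set V} (h : SetsAdjacent G S T) : SetsAdjacent G T S := by
  obtain ⟨p, hp, q, hq, hpq⟩ := h
  exact ⟨q, hq, p, hp, hpq.symm⟩

theorem WalkConnected.exists_walk_union {S T : Set V} (hS : WalkConnected G S)
    (hT : WalkConnected G T) (h : SetsAdjacent G S T) {p q : V} (hp : p ∈ S) (hq : q ∈ T) :
    ∃ w : G.Walk p q, ∀ x ∈ w.support, x ∈ S ∪ T := by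
  obtain ⟨s, hs, t, ht, hst⟩ := h
  obtain ⟨w₁, h₁⟩ := hS p hp s hs
  obtain ⟨w₂, h₂⟩ := hT t ht q hq
  refine ⟨w₁.append (.cons hst w₂), fun x hx => ?_⟩
  rw [SimpleGraph.Walk.mem_support_append_iff, SimpleGraph.Walk.support_cons, List.mem_cons] at hx
  rcases hx with hx | rfl | hx
  · exact Or.inl (h₁ x hx)
  · exact Or.inl hs
  · exact Or.inr (h₂ x hx)

theorem WalkConnected.union {S T : Set V} (hS : WalkConnected G S) (hT : WalkConnected G T)
    (h : SetsAdjacent G S T) : WalkConnected G (S ∪ T) := by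
  rintro p (hp | hp) q (hq | hq)
  · obtain ⟨w, hw⟩ := hS p hp q hq
    exact ⟨w, fun x hx => Or.inl (hw x hx)⟩
  · exact hS.exists_walk_union hT h hp hq
  · rw [Set.union_comm]
    exact hT.exists_walk_union hS h.symm hp hq
  · obtain ⟨w, hw⟩ := hT p hp q hq
    exact ⟨w, fun x hx => Or.inr (hw x hx)⟩

/-- A walk that ends in `S` contains a path from its start to a first vertex of `S`. -/
theorem SimpleGraph.Walk.exists_path_to_set {S : Set V} {u z : V} (w : G.Walk u z) (hz : z ∈ S) :
    ∃ a ∈ S, ∃ R : G.Walk a u, R.IsPath ∧ (∀ x ∈ R.support, x ∈ w.support) ∧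
      ∀ x ∈ R.support, x ∈ S → x = a := by
  classical
  suffices h : ∃ a ∈ S, ∃ R : G.Walk a u, (∀ x ∈ R.support, x ∈ w.support) ∧
      ∀ x ∈ R.support, x ∈ S → x = a by
    obtain ⟨a, ha, R, h₁, h₂⟩ := h
    exact ⟨a, ha, R.bypass, R.bypass_isPath, fun x hx => h₁ x (R.support_bypass_subset_support hx),
      fun x hx => h₂ x (R.support_bypass_subset_support hx)⟩
  induction w with
  | nil => exact ⟨_, hz, .nil, by simp, by simp⟩
  | @cons u v z h w ih =>
    by_cases hu : u ∈ S
    · exact ⟨u, hu, .nil, by simp, by simp⟩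
    · obtain ⟨a, ha, R, h₁, h₂⟩ := ih hz
      refine ⟨a, ha, R.append (.cons h.symm .nil), fun x hx => ?_, fun x hx hxS => ?_⟩
      all_goals
        rw [SimpleGraph.Walk.mem_support_append_iff] at hx
        simp only [SimpleGraph.Walk.support_cons, SimpleGraph.Walk.support_nil, List.mem_cons,
          List.not_mem_nil, or_false] at hx ⊢
      · rcases hx with hx | rfl | rfl
        · exact Or.inr (h₁ x hx)
        · exact Or.inr w.start_mem_support
        · exact Or.inl rfl
      · rcases hx with hx | rfl | rfl
        · exact h₂ x hx hxS
        · exact h₂ x R.end_mem_support hxS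
        · exact absurd hxS hu

/-- A path from `a` followed by a walk in `B` yields an edge at `a` and a walk that avoids `a`. -/
theorem SimpleGraph.Walk.IsPath.exists_leg {B : Set V} (hB : WalkConnected G B) {a p b' b : V}
    {R : G.Walk a p} (hR : R.IsPath) (hb' : b' ∈ B) (hb : b ∈ B) (h : G.Adj p b') :
    ∃ s, G.Adj a s ∧ ∃ w : G.Walk s b, ∀ x ∈ w.support, (x ∈ R.support ∧ x ≠ a) ∨ x ∈ B := by
  obtain ⟨w, hw⟩ := hB b' hb' b hb
  cases R with
  | nil => exact ⟨b', h, w, fun x hx => Or.inr (hw x hx)⟩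
  | @cons _ s _ hs R =>
    refine ⟨s, hs, R.append (.cons h w), fun x hx => ?_⟩
    rw [SimpleGraph.Walk.cons_isPath_iff] at hR
    rw [SimpleGraph.Walk.mem_support_append_iff, SimpleGraph.Walk.support_cons,
      List.mem_cons] at hx
    have key : ∀ y ∈ R.support, y ∈ (SimpleGraph.Walk.cons hs R).support ∧ y ≠ a := fun y hy =>
      ⟨by simp [hy], fun e => hR.2 (e ▸ hy)⟩
    rcases hx with hx | rfl | hx
    · exact Or.inl (key x hx)
    · exact Or.inl (key x R.end_mem_support)
    · exact Or.inr (hw x hx)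

/-- From a suitable vertex `a` of a connected set `A` three walks that share only `a` lead to three
given vertices in sets adjacent to `A`. -/
theorem exists_tripod {A B C D : Set V} (hA : WalkConnected G A) (hB : WalkConnected G B)
    (hC : WalkConnected G C) (hD : WalkConnected G D) (hAB : SetsAdjacent G A B)
    (hAC : SetsAdjacent G A C) (hAD : SetsAdjacent G A D) (dAB : Disjoint A B) (dAC : Disjoint A C)
    (dAD : Disjoint A D) (dBC : Disjoint B C) (dBD : Disjoint B D) (dCD : Disjoint C D) {b c d : V}
    (hb : b ∈ B) (hc : c ∈ C) (hd : d ∈ D) :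
    ∃ a ∈ A, ∃ s t u, G.Adj a s ∧ G.Adj a t ∧ G.Adj a u ∧
      ∃ (x : G.Walk s b) (y : G.Walk t c) (z : G.Walk u d),
        (∀ p ∈ x.support, (p ∈ A ∪ B) ∧ p ≠ a) ∧ (∀ p ∈ y.support, (p ∈ A ∪ C) ∧ p ≠ a) ∧
        (∀ p ∈ z.support, (p ∈ A ∪ D) ∧ p ≠ a) ∧ x.support.Disjoint y.support ∧
        x.support.Disjoint z.support ∧ y.support.Disjoint z.support := by
  classical
  obtain ⟨pB, hpB, b', hb', eB⟩ := hAB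
  obtain ⟨pC, hpC, c', hc', eC⟩ := hAC
  obtain ⟨pD, hpD, d', hd', eD⟩ := hAD
  -- Inside `A`, take a path `P` between the contacts with `B` and `C`, and a walk from the contact
  -- with `D` until it first hits `P`, at `a`. The two halves of `P` and this branch are the legs.
  obtain ⟨P₀, hP₀⟩ := hA pB hpB pC hpC
  obtain ⟨P, hP, hPA⟩ : ∃ P : G.Walk pB pC, P.IsPath ∧ ∀ x ∈ P.support, x ∈ A :=
    ⟨P₀.bypass, P₀.bypass_isPath, fun x hx => hP₀ x (P₀.support_bypass_subset_support hx)⟩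
  obtain ⟨Q, hQ⟩ := hA pD hpD pB hpB
  obtain ⟨a, ha, R, hR, hRQ, hRP⟩ :=
    Q.exists_path_to_set (S := {x | x ∈ P.support}) P.start_mem_support
  have hsplit := P.take_spec ha
  have hnd : ((P.takeUntil a ha).append (P.dropUntil a ha)).support.Nodup := by
    rw [hsplit]; exact hP.support_nodup
  rw [SimpleGraph.Walk.support_append, List.nodup_append] at hnd
  have htd : ∀ x ∈ (P.takeUntil a ha).support, x ∈ (P.dropUntil a ha).support → x = a := by
    intro x hx hx'
    rw [← SimpleGraph.Walk.cons_tail_support, List.mem_cons] at hx'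
    rcases hx' with hx' | hx'
    · exact hx'
    · exact absurd rfl (hnd.2.2 x hx x hx')
  have hT : ∀ x ∈ (P.takeUntil a ha).support, x ∈ P.support := fun x hx =>
    P.support_takeUntil_subset_support ha hx
  have hD' : ∀ x ∈ (P.dropUntil a ha).support, x ∈ P.support := fun x hx =>
    P.support_dropUntil_subset_support ha hx
  obtain ⟨s, has, x, hx⟩ := SimpleGraph.Walk.IsPath.exists_leg hB (hP.takeUntil ha).reverse hb' hb eB
  obtain ⟨t, hat, y, hy⟩ := SimpleGraph.Walk.IsPath.exists_leg hC (hP.dropUntil ha) hc' hc eC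
  obtain ⟨u, hau, z, hz⟩ := SimpleGraph.Walk.IsPath.exists_leg hD hR hd' hd eD
  simp only [SimpleGraph.Walk.support_reverse, List.mem_reverse] at hx
  have haA : a ∈ A := hPA a ha
  have hRA : ∀ x ∈ R.support, x ∈ A := fun x hx => hQ x (hRQ x hx)
  rw [Set.disjoint_left] at dAB dAC dAD dBC dBD dCD
  refine ⟨a, haA, s, t, u, has, hat, hau, x, y, z, ?_, ?_, ?_, ?_, ?_, ?_⟩
  · intro p hp
    rcases hx p hp with ⟨h, h'⟩ | h
    · exact ⟨Or.inl (hPA p (hT p h)), h'⟩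
    · exact ⟨Or.inr h, fun e => dAB haA (e ▸ h)⟩
  · intro p hp
    rcases hy p hp with ⟨h, h'⟩ | h
    · exact ⟨Or.inl (hPA p (hD' p h)), h'⟩
    · exact ⟨Or.inr h, fun e => dAC haA (e ▸ h)⟩
  · intro p hp
    rcases hz p hp with ⟨h, h'⟩ | h
    · exact ⟨Or.inl (hRA p h), h'⟩
    · exact ⟨Or.inr h, fun e => dAD haA (e ▸ h)⟩
  · intro p hp hp'
    rcases hx p hp with ⟨h, h'⟩ | h <;> rcases hy p hp' with ⟨k, k'⟩ | k
    · exact h' (htd p h k)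
    · exact dAC (hPA p (hT p h)) k
    · exact dAB (hPA p (hD' p k)) h
    · exact dBC h k
  · intro p hp hp'
    rcases hx p hp with ⟨h, h'⟩ | h <;> rcases hz p hp' with ⟨k, k'⟩ | k
    · exact h' (hRP p k (hT p h))
    · exact dAD (hPA p (hT p h)) k
    · exact dAB (hRA p k) h
    · exact dBD h k
  · intro p hp hp'
    rcases hy p hp with ⟨h, h'⟩ | h <;> rcases hz p hp' with ⟨k, k'⟩ | k
    · exact h' (hRP p k (hD' p h))
    · exact dAD (hPA p (hD' p h)) k
    · exact dAC (hRA p k) h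
    · exact dCD h k

end Walks

/-! ### Crossing parity in the plane grid -/

/-- The infinite square grid. -/
def planeGrid : SimpleGraph (ℤ × ℤ) where
  Adj p q := (p.1 = q.1 ∧ (p.2 + 1 = q.2 ∨ q.2 + 1 = p.2)) ∨
    (p.2 = q.2 ∧ (p.1 + 1 = q.1 ∨ q.1 + 1 = p.1))
  symm := ⟨fun p q h => by omega⟩
  loopless := ⟨fun p h => by omega⟩

/-- `1` if `z` lies above the right end of the horizontal grid-edge `rs`. -/
def aboveRight (r s z : ℤ × ℤ) : ZMod 2 :=
  if r.2 = s.2 ∧ max r.1 s.1 = z.1 ∧ r.2 < z.2 then 1 else 0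

/-- `1` if `z` lies below the left end of the horizontal grid-edge `pq`. -/
def belowLeft (p q z : ℤ × ℤ) : ZMod 2 :=
  if p.2 = q.2 ∧ min p.1 q.1 = z.1 ∧ z.2 < p.2 then 1 else 0

/-- The parity of the number of crossings of the grid-edge `pq` with the grid-edge `rs` shifted by
`(1/2, 1/2)`. -/
def edgeCrossing (p q r s : ℤ × ℤ) : ZMod 2 :=
  aboveRight r s p + aboveRight r s q + belowLeft p q r + belowLeft p q s

theorem planeGrid_adj_iff {p q : ℤ × ℤ} : planeGrid.Adj p q ↔
    q = (p.1, p.2 + 1) ∨ q = (p.1, p.2 - 1) ∨ q = (p.1 + 1, p.2) ∨ q = (p.1 - 1, p.2) := by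
  obtain ⟨p₁, p₂⟩ := p
  obtain ⟨q₁, q₂⟩ := q
  simp only [planeGrid, Prod.mk.injEq]
  omega

/-- A grid-edge can cross a shifted one only if the two unshifted edges share an end. -/
theorem edgeCrossing_eq_zero {p q r s : ℤ × ℤ} (hpq : planeGrid.Adj p q) (hrs : planeGrid.Adj r s)
    (hpr : p ≠ r) (hps : p ≠ s) (hqr : q ≠ r) (hqs : q ≠ s) : edgeCrossing p q r s = 0 := by
  obtain ⟨p₁, p₂⟩ := p
  obtain ⟨r₁, r₂⟩ := r
  unfold edgeCrossing aboveRight belowLeft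
  rcases planeGrid_adj_iff.1 hpq with rfl | rfl | rfl | rfl <;>
  rcases planeGrid_adj_iff.1 hrs with rfl | rfl | rfl | rfl <;>
  clear hpq hrs <;>
  simp only [ne_eq, Prod.mk.injEq, left_eq_add, one_ne_zero,
    false_and, if_false, true_and, add_zero, zero_add] at * <;>
  split_ifs <;> first | rfl | (exfalso; omega)

/-- At a common end the shift produces a crossing just for the ordered pairs (right, down) and (up,
left). -/
theorem edgeCrossing_eq_ite {a s t : ℤ × ℤ} (hs : planeGrid.Adj a s) (ht : planeGrid.Adj a t)
    (hst : s ≠ t) : edgeCrossing a s a t =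
      if (a.1 < s.1 ∧ t.2 < a.2) ∨ (a.2 < s.2 ∧ t.1 < a.1) then 1 else 0 := by
  obtain ⟨a₁, a₂⟩ := a
  unfold edgeCrossing aboveRight belowLeft
  rcases planeGrid_adj_iff.1 hs with rfl | rfl | rfl | rfl <;>
  rcases planeGrid_adj_iff.1 ht with rfl | rfl | rfl | rfl <;>
  simp at hst ⊢
  all_goals omega

/-- The pairs {right, down} and {up, left} partition the four directions, so any three directions
contain exactly one of them, and it counts in one of its two orders. -/
theorem edgeCrossing_tripod {a s t u : ℤ × ℤ} (hs : planeGrid.Adj a s) (ht : planeGrid.Adj a t)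
    (hu : planeGrid.Adj a u) (hst : s ≠ t) (hsu : s ≠ u) (htu : t ≠ u) :
    edgeCrossing a t a s + edgeCrossing a u a s + edgeCrossing a s a t + edgeCrossing a u a t +
      edgeCrossing a s a u + edgeCrossing a t a u = 1 := by
  rw [edgeCrossing_eq_ite ht hs hst.symm, edgeCrossing_eq_ite hu hs hsu.symm,
    edgeCrossing_eq_ite hs ht hst, edgeCrossing_eq_ite hu ht htu.symm,
    edgeCrossing_eq_ite hs hu hsu, edgeCrossing_eq_ite ht hu htu]
  have h₁ : ¬a.1 < a.1 - 1 := by omega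
  have h₂ : ¬a.2 < a.2 - 1 := by omega
  rcases planeGrid_adj_iff.1 hs with rfl | rfl | rfl | rfl <;>
  rcases planeGrid_adj_iff.1 ht with rfl | rfl | rfl | rfl <;>
  (first | exact absurd rfl hst | skip) <;>
  rcases planeGrid_adj_iff.1 hu with rfl | rfl | rfl | rfl <;>
  first | exact absurd rfl hsu | exact absurd rfl htu | simp [h₁, h₂]

/-- The crossing parity of two walks of the grid, the second one shifted by `(1/2, 1/2)`. -/
def walkCrossing {p q r s : ℤ × ℤ} (w : planeGrid.Walk p q) (w' : planeGrid.Walk r s) : ZMod 2 :=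
  (w.darts.map fun d => (w'.darts.map fun d' =>
    edgeCrossing d.fst d.snd d'.fst d'.snd).sum).sum

/-- The crossing parity of two walks is determined by the ends of each relative to the other. -/
theorem walkCrossing_eq {p q r s : ℤ × ℤ} (w : planeGrid.Walk p q) (w' : planeGrid.Walk r s) :
    walkCrossing w w' =
      (w'.darts.map fun d => aboveRight d.fst d.snd p).sum +
      (w'.darts.map fun d => aboveRight d.fst d.snd q).sum +
      (w.darts.map fun d => belowLeft d.fst d.snd r).sum +
      (w.darts.map fun d => belowLeft d.fst d.snd s).sum := by
  have h2 : (2 : ZMod 2) = 0 := rfl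
  have single : ∀ {a b : ℤ × ℤ}, (w'.darts.map fun d' => edgeCrossing a b d'.fst d'.snd).sum =
      (w'.darts.map fun d => aboveRight d.fst d.snd a).sum +
      (w'.darts.map fun d => aboveRight d.fst d.snd b).sum + belowLeft a b r + belowLeft a b s := by
    intro a b
    induction w' with
    | nil => simp only [SimpleGraph.Walk.darts_nil, List.map_nil, List.sum_nil]
             linear_combination (- belowLeft a b _) * h2
    | @cons r t s h w' ih =>
      simp only [SimpleGraph.Walk.darts_cons, List.map_cons, List.sum_cons]
      rw [ih]
      unfold edgeCrossing
      linear_combination (belowLeft a b t) * h2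
  unfold walkCrossing
  induction w with
  | nil => simp only [SimpleGraph.Walk.darts_nil, List.map_nil, List.sum_nil]
           linear_combination
             (- (w'.darts.map fun d => aboveRight d.fst d.snd _).sum) * h2
  | @cons p t q h w ih =>
    simp only [SimpleGraph.Walk.darts_cons, List.map_cons, List.sum_cons]
    rw [ih, single]
    linear_combination ((w'.darts.map fun d => aboveRight d.fst d.snd t).sum) * h2

theorem walkCrossing_eq_zero {p q r s : ℤ × ℤ} {w : planeGrid.Walk p q} {w' : planeGrid.Walk r s}
    (h : w.support.Disjoint w'.support) : walkCrossing w w' = 0 := by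
  unfold walkCrossing
  refine List.sum_eq_zero fun a ha => ?_
  obtain ⟨d, hd, rfl⟩ := List.mem_map.1 ha
  refine List.sum_eq_zero fun b hb => ?_
  obtain ⟨d', hd', rfl⟩ := List.mem_map.1 hb
  have h₁ := w.dart_fst_mem_support_of_mem_darts hd
  have h₂ := w.dart_snd_mem_support_of_mem_darts hd
  have h₃ := w'.dart_fst_mem_support_of_mem_darts hd'
  have h₄ := w'.dart_snd_mem_support_of_mem_darts hd'
  exact edgeCrossing_eq_zero d.adj d'.adj (fun e => h h₁ (e ▸ h₃)) (fun e => h h₁ (e ▸ h₄))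
    (fun e => h h₂ (e ▸ h₃)) (fun e => h h₂ (e ▸ h₄))

/-- Walks that share only their start cross as their first edges do. -/
theorem walkCrossing_cons {a s t b c : ℤ × ℤ} (hs : planeGrid.Adj a s) (ht : planeGrid.Adj a t)
    {x : planeGrid.Walk s b} {y : planeGrid.Walk t c} (hx : a ∉ x.support) (hy : a ∉ y.support)
    (hxy : x.support.Disjoint y.support) :
    walkCrossing (.cons hs x) (.cons ht y) = edgeCrossing a s a t := by
  have h₁ : walkCrossing (.cons hs .nil) y = 0 := walkCrossing_eq_zero fun z hz hz' => by
    simp only [SimpleGraph.Walk.support_cons, SimpleGraph.Walk.support_nil, List.mem_cons,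
      List.not_mem_nil, or_false] at hz
    rcases hz with rfl | rfl
    · exact hy hz'
    · exact hxy x.start_mem_support hz'
  have h₂ : walkCrossing x (.cons ht y) = 0 := walkCrossing_eq_zero fun z hz hz' => by
    rw [SimpleGraph.Walk.support_cons, List.mem_cons] at hz'
    rcases hz' with rfl | hz'
    · exact hx hz
    · exact hxy hz hz'
  unfold walkCrossing at *
  simp only [SimpleGraph.Walk.darts_cons, SimpleGraph.Walk.darts_nil, List.map_cons, List.map_nil,
    List.sum_cons, List.sum_nil, add_zero] at h₁ h₂ ⊢
  rw [h₁, h₂]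
  ring

theorem List.disjoint_of_subset_sets {α : Type*} {l l' : List α} {S T : Set α} (hST : _root_.Disjoint S T)
    (h : ∀ x ∈ l, x ∈ S) (h' : ∀ x ∈ l', x ∈ T) : l.Disjoint l' := fun x hx hx' =>
  Set.disjoint_left.1 hST (h x hx) (h' x hx')

/-- In the plane grid, a triangle of connected sets separates any two connected sets that are
adjacent to all three. -/
theorem planeGrid_separates {A B C D E : Set (ℤ × ℤ)} (hA : WalkConnected planeGrid A)
    (hB : WalkConnected planeGrid B) (hC : WalkConnected planeGrid C)
    (hD : WalkConnected planeGrid D) (hE : WalkConnected planeGrid E)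
    (hAB : SetsAdjacent planeGrid A B) (hAC : SetsAdjacent planeGrid A C)
    (hAD : SetsAdjacent planeGrid A D) (hAE : SetsAdjacent planeGrid A E)
    (hBC : SetsAdjacent planeGrid B C) (hBD : SetsAdjacent planeGrid B D)
    (hBE : SetsAdjacent planeGrid B E) (hCD : SetsAdjacent planeGrid C D)
    (hCE : SetsAdjacent planeGrid C E)
    (dAB : Disjoint A B) (dAC : Disjoint A C) (dAD : Disjoint A D) (dAE : Disjoint A E)
    (dBC : Disjoint B C) (dBD : Disjoint B D) (dBE : Disjoint B E) (dCD : Disjoint C D)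
    (dCE : Disjoint C E) (dDE : Disjoint D E) {d e : ℤ × ℤ} (hd : d ∈ D) (he : e ∈ E)
    (q : planeGrid.Walk d e) : ∃ x ∈ q.support, x ∈ A ∪ B ∪ C := by
  -- If `q` avoids `A ∪ B ∪ C`, the walks below draw `K₅` on `a`, `b`, `c`, `d`, `e` so that
  -- nonadjacent edges are disjoint. The tripod makes the three edges from `a` to `b`, `c`, `d`
  -- share only `a`.
  by_contra hq
  push Not at hq
  obtain ⟨b, hb, -⟩ := id hBC
  obtain ⟨c, hc, -⟩ := id hCD
  obtain ⟨a, ha, s, t, u, has, hat, hau, x, y, z, hx, hy, hz, dxy, dxz, dyz⟩ :=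
    exists_tripod hA hB hC hD hAB hAC hAD dAB dAC dAD dBC dBD dCD hb hc hd
  obtain ⟨wBC, hwBC⟩ := hB.exists_walk_union hC hBC hb hc
  obtain ⟨wBD, hwBD⟩ := hB.exists_walk_union hD hBD hb hd
  obtain ⟨wCD, hwCD⟩ := hC.exists_walk_union hD hCD hc hd
  obtain ⟨qA, hqA⟩ := hA.exists_walk_union hE hAE ha he
  obtain ⟨qB, hqB⟩ := hB.exists_walk_union hE hBE hb he
  obtain ⟨qC, hqC⟩ := hC.exists_walk_union hE hCE hc he
  have sx : ∀ p ∈ (SimpleGraph.Walk.cons has x).support, p ∈ A ∪ B := fun p hp => by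
    rw [SimpleGraph.Walk.support_cons, List.mem_cons] at hp
    exact hp.elim (fun h => Or.inl (h ▸ ha)) fun h => (hx p h).1
  have sy : ∀ p ∈ (SimpleGraph.Walk.cons hat y).support, p ∈ A ∪ C := fun p hp => by
    rw [SimpleGraph.Walk.support_cons, List.mem_cons] at hp
    exact hp.elim (fun h => Or.inl (h ▸ ha)) fun h => (hy p h).1
  have sz : ∀ p ∈ (SimpleGraph.Walk.cons hau z).support, p ∈ A ∪ D := fun p hp => by
    rw [SimpleGraph.Walk.support_cons, List.mem_cons] at hp
    exact hp.elim (fun h => Or.inl (h ▸ ha)) fun h => (hz p h).1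
  have cross : ∀ {S T U R : Set (ℤ × ℤ)}, Disjoint S U → Disjoint S R → Disjoint T U →
      Disjoint T R → ∀ {p q r s : ℤ × ℤ} {w : planeGrid.Walk p q} {w' : planeGrid.Walk r s},
      (∀ x ∈ w.support, x ∈ S ∪ T) → (∀ x ∈ w'.support, x ∈ U ∪ R) → walkCrossing w w' = 0 := by
    intro S T U R h₁ h₂ h₃ h₄ p q r s w w' hw hw'
    refine walkCrossing_eq_zero (List.disjoint_of_subset_sets ?_ hw hw')
    exact (h₁.union_right h₂).union_left (h₃.union_right h₄)
  have dq : Disjoint (A ∪ B ∪ C) {x | x ∈ q.support} := by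
    rw [Set.disjoint_right]
    exact hq
  have hqD : ∀ {p r : ℤ × ℤ} {w : planeGrid.Walk p r} {S T : Set (ℤ × ℤ)}, S ⊆ A ∪ B ∪ C →
      T ⊆ A ∪ B ∪ C → (∀ x ∈ w.support, x ∈ S ∪ T) → walkCrossing w q = 0 :=
    fun hS hT hw => walkCrossing_eq_zero
      (List.disjoint_of_subset_sets (dq.mono_left (Set.union_subset hS hT)) hw fun _ h => h)
  have iA : A ⊆ A ∪ B ∪ C := fun _ h => Or.inl (Or.inl h)
  have iB : B ⊆ A ∪ B ∪ C := fun _ h => Or.inl (Or.inr h)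
  have iC : C ⊆ A ∪ B ∪ C := fun _ h => Or.inr h
  -- The fifteen pairs of nonadjacent edges of `K₅`, each with crossing parity `0`.
  have e₁ := cross dAB.symm dBE dAC.symm dCE hwBC hqA
  have e₂ := cross dAB.symm dBE dAD.symm dDE hwBD hqA
  have e₃ := cross dAC.symm dCE dAD.symm dDE hwCD hqA
  have e₄ := cross dAB dAE dBC.symm dCE sy hqB
  have e₅ := cross dAB dAE dBD.symm dDE sz hqB
  have e₆ := cross dBC.symm dCE dBD.symm dDE hwCD hqB
  have e₇ := cross dAC dAE dBC dBE sx hqC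
  have e₈ := cross dAC dAE dCD.symm dDE sz hqC
  have e₉ := cross dBC dBE dCD.symm dDE hwBD hqC
  have f₁ := hqD iA iB sx
  have f₂ := hqD iA iC sy
  have f₃ := hqD iB iC hwBC
  have g₁ := cross dAC.symm dBC.symm dAD.symm dBD.symm hwCD sx
  have g₂ := cross dAB.symm dBC dAD.symm dCD.symm hwBD sy
  have g₃ := cross dAB.symm dBD dAC.symm dCD hwBC sz
  have nx : a ∉ x.support := fun h => (hx a h).2 rfl
  have ny : a ∉ y.support := fun h => (hy a h).2 rfl
  have nz : a ∉ z.support := fun h => (hz a h).2 rfl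
  have key := edgeCrossing_tripod has hat hau
    (fun h => dxy x.start_mem_support (h ▸ y.start_mem_support))
    (fun h => dxz x.start_mem_support (h ▸ z.start_mem_support))
    (fun h => dyz y.start_mem_support (h ▸ z.start_mem_support))
  rw [← walkCrossing_cons hat has ny nx dxy.symm, ← walkCrossing_cons hau has nz nx dxz.symm,
    ← walkCrossing_cons has hat nx ny dxy, ← walkCrossing_cons hau hat nz ny dyz.symm,
    ← walkCrossing_cons has hau nx nz dxz, ← walkCrossing_cons hat hau ny nz dyz] at key
  rw [walkCrossing_eq] at e₁ e₂ e₃ e₄ e₅ e₆ e₇ e₈ e₉ f₁ f₂ f₃ g₁ g₂ g₃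
  simp only [walkCrossing_eq] at key
  have h2 : (2 : ZMod 2) = 0 := rfl
  refine one_ne_zero (α := ZMod 2) ?_
  rw [← key]
  generalize SimpleGraph.Walk.cons has x = X at *
  generalize SimpleGraph.Walk.cons hat y = Y at *
  generalize SimpleGraph.Walk.cons hau z = Z at *
  -- By `walkCrossing_eq` all parities become sums over ends. The three edges opposite a given edge
  -- form a triangle, so each end occurs twice. Terms cancel mod 2 except for those of `X`, `Y`,
  -- `Z`, which play both roles (shifted and unshifted); what they leave equals the expansion of the
  -- six leg pairs in `key`, whose total is `1`.
  have tot := congrArg₂ (· + ·) (congrArg₂ (· + ·) (congrArg₂ (· + ·) (congrArg₂ (· + ·) e₁ e₂)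
    (congrArg₂ (· + ·) e₃ e₄)) (congrArg₂ (· + ·) (congrArg₂ (· + ·) e₅ e₆)
    (congrArg₂ (· + ·) e₇ e₈))) (congrArg₂ (· + ·) (congrArg₂ (· + ·) (congrArg₂ (· + ·) e₉ f₁)
    (congrArg₂ (· + ·) f₂ f₃)) (congrArg₂ (· + ·) (congrArg₂ (· + ·) g₁ g₂) g₃))
  simp only [add_zero] at tot
  rw [← sub_eq_zero_of_eq tot]
  ring_nf
  simp only [h2, mul_zero, add_zero, zero_add]

/-! ### Lower bound for simple representations -/

section LowerBound

theorem exists_vertical_walk {U : Set (ℤ × ℤ)} {x y : ℤ} (k : ℕ)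
    (h : ∀ t, y ≤ t → t ≤ y + k → (x, t) ∈ U) :
    ∃ w : planeGrid.Walk (x, y) (x, y + k), ∀ p ∈ w.support, p ∈ U := by
  induction k with
  | zero => exact ⟨SimpleGraph.Walk.nil.copy rfl (by simp), fun p hp => by
      rw [SimpleGraph.Walk.support_copy, SimpleGraph.Walk.support_nil, List.mem_singleton] at hp
      exact hp ▸ h y le_rfl (by simp)⟩
  | succ k ih =>
    obtain ⟨w, hw⟩ := ih fun t h₁ h₂ => h t h₁ (by push_cast; omega)
    have hadj : planeGrid.Adj (x, y + k) (x, y + (k + 1 : ℕ)) :=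
      planeGrid_adj_iff.2 (Or.inl (by push_cast; rw [add_assoc]))
    refine ⟨w.concat hadj, fun p hp => ?_⟩
    rw [SimpleGraph.Walk.support_concat, List.mem_append,
      List.mem_singleton] at hp
    rcases hp with hp | rfl
    · exact hw p hp
    · exact h _ (by omega) le_rfl

theorem exists_horizontal_walk {U : Set (ℤ × ℤ)} {x y : ℤ} (k : ℕ)
    (h : ∀ t, x ≤ t → t ≤ x + k → (t, y) ∈ U) :
    ∃ w : planeGrid.Walk (x, y) (x + k, y), ∀ p ∈ w.support, p ∈ U := by
  induction k with
  | zero => exact ⟨SimpleGraph.Walk.nil.copy rfl (by simp), fun p hp => by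
      rw [SimpleGraph.Walk.support_copy, SimpleGraph.Walk.support_nil, List.mem_singleton] at hp
      exact hp ▸ h x le_rfl (by simp)⟩
  | succ k ih =>
    obtain ⟨w, hw⟩ := ih fun t h₁ h₂ => h t h₁ (by push_cast; omega)
    have hadj : planeGrid.Adj (x + k, y) (x + (k + 1 : ℕ), y) :=
      planeGrid_adj_iff.2 (Or.inr (Or.inr (Or.inl (by push_cast; rw [add_assoc]))))
    refine ⟨w.concat hadj, fun p hp => ?_⟩
    rw [SimpleGraph.Walk.support_concat, List.mem_append,
      List.mem_singleton] at hp
    rcases hp with hp | rfl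
    · exact hw p hp
    · exact h _ (by omega) le_rfl

/-- If one of the two vertical rays from `(x, y)` stays in `U`, as do all points outside a horizontal
half-strip of height `H`, then `(x, y)` is joined to `(-1, -1)` in `U`. -/
theorem exists_walk_to_corner {U : Set (ℤ × ℤ)} {H x y : ℕ} (hy : y < H)
    (hout : ∀ p : ℤ × ℤ, p.1 < 0 ∨ p.2 < 0 ∨ (H : ℤ) ≤ p.2 → p ∈ U)
    (hray : (∀ t : ℕ, y ≤ t → t < H → ((x : ℤ), (t : ℤ)) ∈ U) ∨
      (∀ t : ℕ, t ≤ y → ((x : ℤ), (t : ℤ)) ∈ U)) :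
    ∃ w : planeGrid.Walk ((x : ℤ), (y : ℤ)) (-1, -1), ∀ p ∈ w.support, p ∈ U := by
  rcases hray with h | h
  · obtain ⟨w₁, h₁⟩ := exists_vertical_walk (U := U) (x := x) (y := y) (H - y) fun t ht ht' => by
      rcases lt_or_ge t H with hH | hH
      · obtain ⟨t, rfl⟩ := Int.eq_ofNat_of_zero_le (by omega : 0 ≤ t)
        exact h t (by omega) (by omega)
      · exact hout _ (Or.inr (Or.inr hH))
    obtain ⟨w₂, h₂⟩ := exists_horizontal_walk (U := U) (x := -1) (y := H) (x + 1)
      fun t ht ht' => hout _ (Or.inr (Or.inr le_rfl))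
    obtain ⟨w₃, h₃⟩ := exists_vertical_walk (U := U) (x := -1) (y := -1) (H + 1)
      fun t ht ht' => hout _ (Or.inl (by simp))
    have eH : ((x : ℤ), (y : ℤ) + ((H - y : ℕ) : ℤ)) = ((x : ℤ), (H : ℤ)) := by
      rw [Prod.mk.injEq]; omega
    have eW : ((-1 : ℤ) + ((x + 1 : ℕ) : ℤ), (H : ℤ)) = ((x : ℤ), (H : ℤ)) := by
      ext <;> simp
    refine ⟨((w₁.copy rfl eH).append
      (w₂.copy rfl eW).reverse).append
      (w₃.copy rfl (by ext <;> simp)).reverse, fun p hp => ?_⟩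
    simp only [SimpleGraph.Walk.mem_support_append_iff, SimpleGraph.Walk.support_reverse,
      List.mem_reverse, SimpleGraph.Walk.support_copy] at hp
    rcases hp with (hp | hp) | hp
    exacts [h₁ p hp, h₂ p hp, h₃ p hp]
  · obtain ⟨w₁, h₁⟩ := exists_vertical_walk (U := U) (x := x) (y := -1) (y + 1) fun t ht ht' => by
      rcases lt_or_ge t 0 with hH | hH
      · exact hout _ (Or.inr (Or.inl hH))
      · obtain ⟨t, rfl⟩ := Int.eq_ofNat_of_zero_le hH
        exact h t (by omega)
    obtain ⟨w₂, h₂⟩ := exists_horizontal_walk (U := U) (x := -1) (y := -1) (x + 1)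
      fun t ht ht' => hout _ (Or.inr (Or.inl (by simp)))
    refine ⟨(w₁.copy rfl (by ext <;> simp)).reverse.append
      (w₂.copy rfl (by ext <;> simp)).reverse, fun p hp => ?_⟩
    simp only [SimpleGraph.Walk.mem_support_append_iff, SimpleGraph.Walk.support_reverse,
      List.mem_reverse, SimpleGraph.Walk.support_copy] at hp
    rcases hp with hp | hp
    exacts [h₁ p hp, h₂ p hp]

/-- The inclusion of a finite grid into the plane grid. -/
def gridEmbedding (W H : ℕ) : gridGraph W H →g planeGrid where
  toFun p := ((p.1 : ℕ), (p.2 : ℕ))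
  map_rel' {p q} h := by
    rw [gridGraph_adj] at h
    simp only [planeGrid, Fin.ext_iff] at h ⊢
    omega

theorem gridEmbedding_injective (W H : ℕ) : Function.Injective (gridEmbedding W H) := by
  rintro ⟨a, b⟩ ⟨c, d⟩ h
  simp only [gridEmbedding, RelHom.coeFn_mk, Prod.mk.injEq, Nat.cast_inj] at h
  rw [Fin.ext h.1, Fin.ext h.2]

variable {n W H : ℕ} {label : Fin W × Fin H → Fin n}

/-- The grid-points whose label lies in `L`, as points of the plane grid. -/
def labelledPoints (label : Fin W × Fin H → Fin n) (L : Set ℕ) : Set (ℤ × ℤ) :=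
  gridEmbedding W H '' {p | (label p).val ∈ L}

theorem disjoint_labelledPoints {L M : Set ℕ} (h : Disjoint L M) :
    Disjoint (labelledPoints label L) (labelledPoints label M) :=
  (Set.disjoint_image_iff (gridEmbedding_injective W H)).2 (h.preimage fun p => (label p).val)

theorem labelledPoints_union (L M : Set ℕ) :
    labelledPoints label (L ∪ M) = labelledPoints label L ∪ labelledPoints label M := by
  rw [labelledPoints, labelledPoints, labelledPoints, ← Set.image_union]
  rfl

theorem mem_labelledPoints {L : Set ℕ} {p : Fin W × Fin H} :
    gridEmbedding W H p ∈ labelledPoints label L ↔ (label p).val ∈ L :=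
  (gridEmbedding_injective W H).mem_set_image

theorem IsGridRepresentation.walkConnected_singleton {G : SimpleGraph (Fin n)}
    (hrep : IsGridRepresentation G label) (v : Fin n) :
    WalkConnected planeGrid (labelledPoints label {v.val}) := by
  rintro _ ⟨p, hp, rfl⟩ _ ⟨q, hq, rfl⟩
  have hp' : label p = v := Fin.ext hp
  have hq' : label q = v := Fin.ext hq
  obtain ⟨w⟩ := (hrep.connected v).preconnected ⟨p, hp'⟩ ⟨q, hq'⟩
  refine ⟨w.map ((gridEmbedding W H).comp (SimpleGraph.Embedding.induce _).toHom), fun x hx => ?_⟩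
  obtain ⟨y, -, rfl⟩ := List.mem_map.1 ((SimpleGraph.Walk.support_map ..) ▸ hx)
  exact ⟨y, congrArg Fin.val y.2, rfl⟩

theorem IsGridRepresentation.setsAdjacent {G : SimpleGraph (Fin n)}
    (hrep : IsGridRepresentation G label) {u v : Fin n} (h : G.Adj u v) {L M : Set ℕ}
    (hu : u.val ∈ L) (hv : v.val ∈ M) :
    SetsAdjacent planeGrid (labelledPoints label L) (labelledPoints label M) := by
  obtain ⟨p, q, hpq, rfl, rfl⟩ := hrep.edge u v h
  exact ⟨_, mem_labelledPoints.2 hu, _, mem_labelledPoints.2 hv, (gridEmbedding W H).map_adj hpq⟩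

/-- Contracting intervals of the path yields the two sets to be separated. -/
theorem walkConnected_Icc (hrep : IsGridRepresentation (squaredPathCone n) label) {a : ℕ} (k : ℕ)
    (hk : a + k < n) : WalkConnected planeGrid (labelledPoints label (Set.Icc a (a + k))) := by
  induction k with
  | zero =>
    rw [add_zero, Set.Icc_self]
    exact hrep.walkConnected_singleton ⟨a, hk⟩
  | succ k ih =>
    have : Set.Icc a (a + (k + 1)) = Set.Icc a (a + k) ∪ {a + (k + 1)} := by
      ext x
      simp only [Set.mem_Icc, Set.mem_union, Set.mem_singleton_iff]
      omega
    rw [this, labelledPoints_union]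
    refine (ih (by omega)).union (hrep.walkConnected_singleton ⟨a + (k + 1), hk⟩) ?_
    exact hrep.setsAdjacent (u := ⟨a + k, by omega⟩) (v := ⟨a + (k + 1), hk⟩)
      (squaredPathCone_adj_iff_coneEdge.2 (Or.inl ⟨by simp, Or.inr (by simp; omega)⟩))
      (by simp) rfl

/-- Walks inside a column cannot jump over a grid-point. -/
theorem column_walk_lt {S : Set (Fin W × Fin H)} {c : Fin W} {r : Fin H} (hS : ∀ p ∈ S, p.1 = c)
    (hr : (c, r) ∉ S) {p q : S} (w : ((gridGraph W H).induce S).Walk p q)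
    (hp : p.1.2 < r) : q.1.2 < r := by
  induction w with
  | nil => exact hp
  | @cons p t q h w ih =>
    apply ih
    have hadj : (gridGraph W H).Adj p.1 t.1 := h
    have ht : t.1.2 ≠ r := fun e => hr (by rw [← e, ← hS t.1 t.2]; exact t.2)
    rw [gridGraph_adj] at hadj
    rw [ne_eq, Fin.ext_iff] at ht
    rw [Fin.lt_def] at hp ⊢
    simp only [Fin.ext_iff] at hadj
    omega

/-- This is where simplicity enters the lower bound: the points of a column with a given label form
an interval, which cannot lie on both sides of a point outside it. -/
theorem IsSimpleGridRepresentation.vertical_ray {G : SimpleGraph (Fin n)}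
    (hrep : IsSimpleGridRepresentation G label) {c : Fin W} {r : Fin H} {v : Fin n}
    (h : label (c, r) ≠ v) :
    (∀ t, r ≤ t → label (c, t) ≠ v) ∨ (∀ t, t ≤ r → label (c, t) ≠ v) := by
  by_contra! hcon
  obtain ⟨⟨t, hrt, ht⟩, s, hsr, hs⟩ := hcon
  obtain ⟨w⟩ := hrep.column_connected c v ⟨(c, s), rfl, hs⟩ ⟨(c, t), rfl, ht⟩
  have hs' : s < r := hsr.lt_of_ne fun e => h (e ▸ hs)
  exact absurd (column_walk_lt (c := c) (r := r) (fun p hp => hp.1) (fun k => h k.2) w hs')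
    (not_lt.2 hrt)

/-- If the columns of `p` and `q` contain no label `i` or `i + 1`, then the points are not separated
by the labels `0`, `i` and `i + 1`. -/
theorem IsSimpleGridRepresentation.exists_walk_to_corner
    {G : SimpleGraph (Fin n)} (hrep : IsSimpleGridRepresentation G label) {p : Fin W × Fin H}
    {i : ℕ} (hp : (label p).val ≠ 0)
    (hcol : ∀ t, (label (p.1, t)).val ≠ i ∧ (label (p.1, t)).val ≠ i + 1) :
    ∃ w : planeGrid.Walk (gridEmbedding W H p) (-1, -1),
      ∀ x ∈ w.support, x ∉ labelledPoints label {0, i, i + 1} := by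
  have hn : 0 < n := Fin.pos (label p)
  obtain ⟨c, r⟩ := p
  refine _root_.exists_walk_to_corner (U := (labelledPoints label {0, i, i + 1})ᶜ) r.2 ?_ ?_
  · rintro _ hout ⟨q, -, rfl⟩
    have := q.2.2
    simp only [gridEmbedding, RelHom.coeFn_mk] at hout
    omega
  · have key : ∀ t : Fin H, label (c, t) ≠ ⟨0, hn⟩ →
        (((c : ℕ) : ℤ), ((t : ℕ) : ℤ)) ∈ (labelledPoints label {0, i, i + 1})ᶜ := by
      intro t ht hmem
      have := (mem_labelledPoints (p := (c, t))).1 hmem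
      rcases this with h | h | h
      · exact ht (Fin.ext h)
      · exact (hcol t).1 h
      · exact (hcol t).2 h
    -- One ray is free of the apex by simplicity, and `hcol` keeps the whole column free of `i` and
    -- `i + 1`.
    rcases hrep.vertical_ray (v := ⟨0, hn⟩) (c := c) (r := r) fun h => hp (congrArg Fin.val h)
      with h | h
    · exact Or.inl fun t ht htH => key ⟨t, htH⟩ (h _ ht)
    · exact Or.inr fun t ht => key ⟨t, ht.trans_lt r.2⟩ (h _ ht)

/-- Every pair of consecutive labels occurs in the column of a given point labelled `1` or in that
of a given point with the last label. -/
theorem IsSimpleGridRepresentation.exists_label_in_column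
    (hrep : IsSimpleGridRepresentation (squaredPathCone n) label) {p q : Fin W × Fin H}
    (hp : (label p).val = 1) (hq : (label q).val + 1 = n) {i : ℕ} (hi : 2 ≤ i) (hin : i + 2 < n) :
    ∃ t, ((label (p.1, t)).val = i ∨ (label (p.1, t)).val = i + 1) ∨
      ((label (q.1, t)).val = i ∨ (label (q.1, t)).val = i + 1) := by
  by_contra! h
  obtain ⟨w₁, h₁⟩ := hrep.exists_walk_to_corner (p := p) (by omega) fun t => (h t).1
  obtain ⟨w₂, h₂⟩ := hrep.exists_walk_to_corner (p := q) (by omega) fun t => (h t).2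
  have hg := hrep.toIsGridRepresentation
  have cone : ∀ {a b : ℕ} (ha : a < n) (hb : b < n), a < b → (a = 0 ∨ b ≤ a + 2) →
      (squaredPathCone n).Adj ⟨a, ha⟩ ⟨b, hb⟩ := fun ha hb hab h =>
    squaredPathCone_adj_iff_coneEdge.2 (Or.inl ⟨hab, h⟩)
  -- The sets `D` and `E` are the labels `1, …, i - 1` and `i + 2, …, n - 1`. Each touches `0`, `i`
  -- and `i + 1`; the nearest path vertices `i - 1` and `i + 2` are within distance two of both `i`
  -- and `i + 1`.
  have hD := walkConnected_Icc hg (a := 1) (i - 2) (by omega)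
  have hE := walkConnected_Icc hg (a := i + 2) (n - i - 3) (by omega)
  obtain ⟨x, hx, hx'⟩ := planeGrid_separates (hg.walkConnected_singleton ⟨0, by omega⟩)
    (hg.walkConnected_singleton ⟨i, by omega⟩) (hg.walkConnected_singleton ⟨i + 1, by omega⟩) hD hE
    (hg.setsAdjacent (cone (a := 0) (b := i) (by omega) (by omega) (by omega) (by omega)) rfl rfl)
    (hg.setsAdjacent (cone (a := 0) (b := i + 1) (by omega) (by omega) (by omega) (by omega))
      rfl rfl)
    (hg.setsAdjacent (cone (a := 0) (b := 1) (by omega) (by omega) (by omega) (by omega)) rfl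
      (by simp))
    (hg.setsAdjacent (cone (a := 0) (b := i + 2) (by omega) (by omega) (by omega) (by omega)) rfl
      (by simp))
    (hg.setsAdjacent (cone (a := i) (b := i + 1) (by omega) (by omega) (by omega) (by omega))
      rfl rfl)
    (hg.setsAdjacent (cone (a := i - 1) (b := i) (by omega) (by omega) (by omega)
      (by omega)).symm rfl (by simp; omega))
    (hg.setsAdjacent (cone (a := i) (b := i + 2) (by omega) (by omega) (by omega) (by omega))
      rfl (by simp))
    (hg.setsAdjacent (cone (a := i - 1) (b := i + 1) (by omega) (by omega) (by omega)
      (by omega)).symm rfl (by simp; omega))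
    (hg.setsAdjacent (cone (a := i + 1) (b := i + 2) (by omega) (by omega) (by omega) (by omega))
      rfl (by simp))
    (disjoint_labelledPoints (by simp; omega)) (disjoint_labelledPoints (by simp))
    (disjoint_labelledPoints (by simp)) (disjoint_labelledPoints (by simp))
    (disjoint_labelledPoints (by simp)) (disjoint_labelledPoints (by simp; omega))
    (disjoint_labelledPoints (by simp)) (disjoint_labelledPoints (by simp; omega))
    (disjoint_labelledPoints (by simp))
    (disjoint_labelledPoints (Set.disjoint_left.2 fun x h₁ h₂ => by
      have := h₁.2
      have := h₂.1
      omega))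
    (mem_labelledPoints.2 (by simp [hp])) (mem_labelledPoints.2 (by simp; omega))
    (w₁.append w₂.reverse)
  have hx'' : x ∈ labelledPoints label {0, i, i + 1} := by
    rw [← labelledPoints_union, ← labelledPoints_union] at hx'
    convert hx' using 2
    ext y
    simp
    tauto
  rw [SimpleGraph.Walk.mem_support_append_iff, SimpleGraph.Walk.support_reverse,
    List.mem_reverse] at hx
  exact hx.elim (fun k => h₁ x k hx'') fun k => h₂ x k hx''

theorem IsSimpleGridRepresentation.le_height (hn : 3 ≤ n)
    (hrep : IsSimpleGridRepresentation (squaredPathCone n) label) : n ≤ 8 * H := by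
  obtain ⟨p, hp⟩ := hrep.surjective ⟨1, by omega⟩
  obtain ⟨q, hq⟩ := hrep.surjective ⟨n - 1, by omega⟩
  -- The count gives `(n - 3) / 2 ≤ 2 * H`, hence `n ≤ 4 * H + 4`; positivity of `H` absorbs the
  -- constant and leads to the factor `8`.
  have hH : 0 < H := Fin.pos p.2
  have hp' : (label p).val = 1 := congrArg Fin.val hp
  have hq' : (label q).val + 1 = n := by
    rw [hq]
    simp only
    omega
  -- The pairs `2j + 2`, `2j + 3` are disjoint and identified by their common half `j + 1`, so
  -- distinct `j` get distinct points of the two columns.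
  have hex : ∀ j : Fin ((n - 3) / 2), ∃ bt : Bool × Fin H,
      (label (if bt.1 then p.1 else q.1, bt.2)).val / 2 = j + 1 := by
    intro j
    have := j.2
    obtain ⟨t, h | h⟩ := hrep.exists_label_in_column hp' hq' (i := 2 * (j + 1)) (by omega)
      (by omega)
    · exact ⟨(true, t), by simp only [if_true]; omega⟩
    · exact ⟨(false, t), by simp only [Bool.false_eq_true, if_false]; omega⟩
  choose f hf using hex
  have hinj : Function.Injective f := fun j k h => Fin.ext (by
    have h₁ := hf j
    have h₂ := hf k
    rw [h] at h₁
    omega)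
  have hcard := Fintype.card_le_of_injective f hinj
  rw [Fintype.card_prod, Fintype.card_bool, Fintype.card_fin, Fintype.card_fin] at hcard
  omega

end LowerBound

theorem mainTheorem5 :
    ∃ c : ℝ, 0 < c ∧ ∀ n : ℕ, 3 ≤ n →
      ∃ G : SimpleGraph (Fin n),
        IsTriangulatedPlanar G ∧ gridMajorHeight G ≤ 4 ∧
          ∃ h : ℕ, simpleGridMajorHeight G = (h : ℕ∞) ∧ c * (n : ℝ) ≤ (h : ℝ) := by
  refine ⟨1 / 8, by norm_num, fun n hn => ⟨squaredPathCone n,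
    squaredPathCone_isTriangulatedPlanar hn, gridMajorHeight_squaredPathCone_le hn, ?_⟩⟩
  obtain ⟨h, W, heq, label, hrep⟩ := exists_simpleGridMajorHeight_eq hn
  refine ⟨h, heq, ?_⟩
  have : (n : ℝ) ≤ 8 * h := by exact_mod_cast hrep.le_height hn
  linarith
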